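/- Let $n\ge 1$. For real angles $\alpha_k$ $(1\le k\le n)$ and $\phi_{j,k},\psi_{j,k}$ $(1\le j<k\le n)$ define matrices recursively by $V_1=e^{i\alpha_1}$ and, for $m>1$, $$V_m=\begin{bmatrix}V_{m-1}&0\\0&1\end{bmatrix}H_m,\qquad H_m=\Phi_{1,m}\Phi_{2,m}\cdots\Phi_{m-1,m},$$ where $\Phi_{j,m}$ is the $m\times m$ matrix that agrees with the identity outside the rows and columns $j$ and $m$, and whose entries at the positions $(j,j),(j,m),(m,j),(m,m)$ are $$e^{ia}\cos\phi_{j,m},\quad e^{i\psi_{j,m}}\sin\phi_{j,m},\quad -e^{-i\psi_{j,m}}\sin\phi_{j,m},\quad e^{-ia}\cos\phi_{j,m},$$ with $a=\alpha_m$ if $j=1$ and $a=0$ if $j>1$. Call the angles admissible if $-\pi\le\alpha_k,\psi_{j,k}<\pi$ and $0\le\phi_{j,k}\le\pi/2$. 1. (Parametrisation.) $V_n$ is always unitary, every matrix in $\mathrm U(n)$ equals $V_n$ for some admissible angles, and admissible angles with all $\phi_{j,k}\in(0,\pi/2)$ are determined uniquely, among the angles of this kind, by $V_n$. 2. (LU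 decomposition.) Let the angles be admissible. (a) If $V_n=LU$ with $L$ lower triangular with unit diagonal and $U=(u_{j,k})$ upper triangular, then $$u_{1,1}=\exp\Big[i\sum_{j=1}^n\alpha_j\Big]\prod_{k=2}^n\cos\phi_{1,k},\qquad u_{l,l}=e^{-i\alpha_l}\,\frac{\prod_{k=l+1}^n\cos\phi_{l,k}}{\prod_{j=1}^{l-1}\cos\phi_{j,l}}\quad(2\le l\le n),$$ and for $1\le l\le n-1$ the product $u_{1,1}\cdots u_{l,l}$ equals $r_le^{i\varphi_l}$ with $$r_l=\prod_{j=1}^l\prod_{k=l+1}^n\cos\phi_{j,k}>0,\qquad e^{i\varphi_l}=\exp\Big[i\alpha_1+i\sum_{j=l+1}^n\alpha_j\Big].$$ (b) Whether or not such a decomposition exists, for $1\le l\le n-1$ the $l$-th leading principal minor of $V_n$ equals $r_le^{i\varphi_l}$, with $r_l\ge 0$ and $e^{i\varphi_l}$ given by the same formulas, and $\det V_n=e^{i\alpha_1}$. 3. (Haar measure.) There is exactly one left-invariant Haar probability measure on $\mathrm U(n)$, and in these coordinates it reads $$\Big(\prod_{1\le j<k\le n}2(k-j)(\cos\phi_{j,k})^{2(k-j)-1}\sin\phi_{j,k}\,d\phi_{j,k}\Big)\Big(\prod_{j=1}^n\frac{d\alpha_j}{2\pi}\Big)\Big(\prod_{1\le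 j<k\le n}\frac{d\psi_{j,k}}{2\pi}\Big),$$ that is, it is the image of this measure on the set of admissible angles under the map sending the angles to $V_n$. -/

import Mathlib

open MeasureTheory Matrix

noncomputable section

namespace HurwitzU

/-- One-based indices `1 ≤ j < k ≤ n` of the paper are stored zero-based: `k : Fin n` and
`j : Fin k`, so that the family `x` has exactly one entry `x k j` for each pair `j < k`. -/
abbrev PairAngles (n : ℕ) : Type := (k : Fin n) → Fin k → ℝ

/-- The matrix `diag(A, 1)`. -/
def diagOne {m : ℕ} (A : Matrix (Fin m) (Fin m) ℂ) : Matrix (Fin (m + 1)) (Fin (m + 1)) ℂ :=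
  Matrix.reindex finSumFinEquiv finSumFinEquiv
    (Matrix.fromBlocks A 0 0 (1 : Matrix (Fin 1) (Fin 1) ℂ))

/-- The matrix `Φ_{j,n}` with `n = m + 1` and `j` zero-based. It differs from the identity only
in the rows and columns `j` and `n`. The phases `e^{± iα}` on the diagonal are present only in
the first of these matrices. -/
def phiMat {m : ℕ} (α : ℝ) (φ ψ : Fin m → ℝ) (j : Fin m) :
    Matrix (Fin (m + 1)) (Fin (m + 1)) ℂ :=
  let a : ℝ := if j.val = 0 then α else 0
  Matrix.of fun r s =>
    if r = j.castSucc ∧ s = j.castSucc then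
      Complex.exp (Complex.I * (a : ℂ)) * (Real.cos (φ j) : ℂ)
    else if r = j.castSucc ∧ s = Fin.last m then
      Complex.exp (Complex.I * (ψ j : ℂ)) * (Real.sin (φ j) : ℂ)
    else if r = Fin.last m ∧ s = j.castSucc then
      -(Complex.exp (-(Complex.I * (ψ j : ℂ))) * (Real.sin (φ j) : ℂ))
    else if r = Fin.last m ∧ s = Fin.last m then
      Complex.exp (-(Complex.I * (a : ℂ))) * (Real.cos (φ j) : ℂ)
    else if r = s then 1 else 0

/-- The ordered product `H_n = Φ_{1,n} Φ_{2,n} ⋯ Φ_{n-1,n}` with `n = m + 1`. -/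
def prodH {m : ℕ} (α : ℝ) (φ ψ : Fin m → ℝ) : Matrix (Fin (m + 1)) (Fin (m + 1)) ℂ :=
  (List.ofFn (phiMat α φ ψ)).prod

/-- The iterative parametrisation: `V_1 = e^{iα_1}` and `V_n = diag(V_{n-1}, 1) H_n` for `n > 1`,
where `H_n` is built from the angles `α_n`, `φ_{j,n}`, `ψ_{j,n}` with `1 ≤ j < n`.
(For `n = 0` it is the empty matrix.) -/
def V : (n : ℕ) → (Fin n → ℝ) → PairAngles n → PairAngles n → Matrix (Fin n) (Fin n) ℂ
  | 0, _, _, _ => 1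
  | 1, α, _, _ => Matrix.of fun _ _ => Complex.exp (Complex.I * (α 0 : ℂ))
  | m + 2, α, φ, ψ =>
    diagOne (V (m + 1) (fun k => α k.castSucc) (fun k => φ k.castSucc) (fun k => ψ k.castSucc)) *
      prodH (m := m + 1) (α (Fin.last (m + 1))) (φ (Fin.last (m + 1))) (ψ (Fin.last (m + 1)))

/-- The ranges `-π ≤ α_k, ψ_{j,k} < π` and `0 ≤ φ_{j,k} ≤ π/2`. -/
structure InRange {n : ℕ} (α : Fin n → ℝ) (φ ψ : PairAngles n) : Prop where
  alpha : ∀ k, α k ∈ Set.Ico (-Real.pi) Real.pi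
  phi : ∀ k j, φ k j ∈ Set.Icc 0 (Real.pi / 2)
  psi : ∀ k j, ψ k j ∈ Set.Ico (-Real.pi) Real.pi

/-- `A = L U` is an LU decomposition: `L` is lower triangular with ones on the diagonal and
`U` is upper triangular. -/
structure IsLU {n : ℕ} (A L U : Matrix (Fin n) (Fin n) ℂ) : Prop where
  lower : ∀ i j, i < j → L i j = 0
  unit : ∀ i, L i i = 1
  upper : ∀ i j, j < i → U i j = 0
  eq : A = L * U

/-- The top left `l × l` block. -/
def leading {n : ℕ} (A : Matrix (Fin n) (Fin n) ℂ) (l : ℕ) (hl : l ≤ n) :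
    Matrix (Fin l) (Fin l) ℂ :=
  A.submatrix (Fin.castLE hl) (Fin.castLE hl)

/-- The claimed value of the diagonal entry `u_{l,l}` (with `l` zero-based):
`exp(i ∑_j α_j) ∏_{k > 1} cos φ_{1,k}` for the first one, and
`e^{-iα_l} ∏_{k > l} cos φ_{l,k} / ∏_{j < l} cos φ_{j,l}` for the others. -/
def uDiag {n : ℕ} (α : Fin n → ℝ) (φ : PairAngles n) (l : Fin n) : ℂ :=
  if l.val = 0 then
    Complex.exp (Complex.I * ((∑ j, α j : ℝ) : ℂ)) *
      ((∏ k : {k : Fin n // l < k}, Real.cos (φ k.1 ⟨l, k.2⟩) : ℝ) : ℂ)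
  else
    Complex.exp (-(Complex.I * (α l : ℂ))) *
      (((∏ k : {k : Fin n // l < k}, Real.cos (φ k.1 ⟨l, k.2⟩)) /
        (∏ j : Fin l, Real.cos (φ l j)) : ℝ) : ℂ)

/-- The radius `r_l = ∏_{j ≤ l} ∏_{k > l} cos φ_{j,k}` (`l` is a size, `j` and `k` are
one-based here; zero-based these are the `j < l` and the `k ≥ l`). -/
def radius {n : ℕ} (φ : PairAngles n) (l : ℕ) : ℝ :=
  ∏ k : Fin n, if l ≤ k.val then
    ∏ j : Fin k, (if j.val < l then Real.cos (φ k j) else 1) else 1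

/-- The argument `α_1 + ∑_{j = l+1}^n α_j` of the complex phase, with one-based `j`. -/
def phaseArg {n : ℕ} (hn : 0 < n) (α : Fin n → ℝ) (l : ℕ) : ℝ :=
  α ⟨0, hn⟩ + ∑ j : Fin n, if l ≤ j.val then α j else 0

/-- The measure `dα / 2π` on `[-π, π)`. -/
def angleMeasure : Measure ℝ :=
  ENNReal.ofReal (1 / (2 * Real.pi)) • volume.restrict (Set.Ico (-Real.pi) Real.pi)

/-- The measure `2 d (cos φ)^{2d-1} sin φ dφ` on `[0, π/2]`. -/
def phiMeasure (d : ℕ) : Measure ℝ :=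
  (volume.restrict (Set.Icc 0 (Real.pi / 2))).withDensity fun φ =>
    ENNReal.ofReal (2 * (d : ℝ) * Real.cos φ ^ (2 * d - 1) * Real.sin φ)

/-- The product measure
`∏_{j<k} 2(k-j) (cos φ_{j,k})^{2(k-j)-1} sin φ_{j,k} dφ_{j,k} ∏_j dα_j/2π ∏_{j<k} dψ_{j,k}/2π`
on the triples `(α, φ, ψ)`. The subtraction does not truncate, since `j : Fin k`. -/
def coordMeasure (n : ℕ) : Measure ((Fin n → ℝ) × PairAngles n × PairAngles n) :=
  (Measure.pi fun _ : Fin n => angleMeasure).prod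
    ((Measure.pi fun k : Fin n => Measure.pi fun j : Fin k => phiMeasure (k.val - j.val)).prod
      (Measure.pi fun k : Fin n => Measure.pi fun _ : Fin k => angleMeasure))

/-- The unitary group carries its Borel `σ`-algebra. -/
instance instMeasurableSpaceUnitary (n : ℕ) : MeasurableSpace (unitaryGroup (Fin n) ℂ) :=
  borel _

instance instBorelSpaceUnitary (n : ℕ) : BorelSpace (unitaryGroup (Fin n) ℂ) := ⟨rfl⟩

end HurwitzU

end

open MeasureTheory Matrix
open scoped ENNReal

noncomputable section

namespace HurwitzU

/-! The recursion peels off the last row. Left multiplication by diag(A, 1) does not touch the last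
row, so V_m and H_m have the same last row, and that row is a unit vector of ℂ^m written in
spherical coordinates (`prodH_last`): each entry is a product of cosines times one sine with a
phase, and the last entry is the product of all cosines with the phase of α. Two unitary matrices
with the same last row differ by a left factor diag(A, 1) with A unitary (`exists_eq_diagOne_mul`).
By induction, existence and uniqueness of the angles reduce to existence and uniqueness of spherical
coordinates (`exists_prodH_last_eq`, `prodH_injective`).

For the minors, each Φ_{j,m} mixes only the columns j and m, so H_m without its last row and column
is upper triangular with known diagonal. Hence for l < m the l-th leading minor of diag(A, 1) H_m is
that of A times the first l diagonal entries of H_m (`det_leading_diagOne_mul_prodH`); with det Φ =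
1 this yields `det_leading_V`. In an LU decomposition the l-th leading minor is the product of the
first l diagonal entries of U. These are nonzero because V is invertible, so each diagonal entry is
a quotient of consecutive minors.

For Haar measure, let g be Haar distributed on U(m) and H independent of g with last row uniform on
the sphere. Averaging a function over g leaves a function of the last row of H alone, and the law of
that row is unitarily invariant; so H may be multiplied on the right by a Haar distributed W, and
left invariance absorbs everything else (`lintegral_diagOneU_mul`). It remains to see that the given
densities make the last row of H_m uniform (`map_prodH_last`) and that the iterated measure
`sphereMeasure` is unitarily invariant (`map_vecMul_sphereMeasure`). The latter holds because
`sphereMeasure` is, up to a constant, the angular part of Lebesgue measure on ℂ^m, on which a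
unitary matrix has real Jacobian |det|² = 1. -/

/-- The phase `e^{i a}` of `Φ_{j,n}`. -/
def phase {m : ℕ} (α : ℝ) (j : Fin m) : ℂ :=
  Complex.exp (Complex.I * ((if j.val = 0 then α else 0 : ℝ) : ℂ))

/-- The lower right entry `e^{-ia} cos φ` of `Φ_{j,n}`. -/
def cosCoef {m : ℕ} (α : ℝ) (φ : Fin m → ℝ) (j : Fin m) : ℂ :=
  Complex.exp (-(Complex.I * ((if j.val = 0 then α else 0 : ℝ) : ℂ))) * (Real.cos (φ j) : ℂ)

/-- The lower left entry `-e^{-iψ} sin φ` of `Φ_{j,n}`. -/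
def sinCoef {m : ℕ} (φ ψ : Fin m → ℝ) (j : Fin m) : ℂ :=
  -(Complex.exp (-(Complex.I * (ψ j : ℂ))) * (Real.sin (φ j) : ℂ))

/-! ### The rotations Φ and the entries of their product H. -/

section phiMat

variable {m : ℕ} (α : ℝ) (φ ψ : Fin m → ℝ) (j : Fin m)

lemma phiMat_castSucc_castSucc (r s : Fin m) :
    phiMat α φ ψ j r.castSucc s.castSucc =
      if s = j ∧ r = j then phase α j * (Real.cos (φ j) : ℂ) else if r = s then 1 else 0 := by
  have h1 : s.castSucc ≠ Fin.last m := s.castSucc_ne_last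
  have h2 : r.castSucc ≠ Fin.last m := r.castSucc_ne_last
  simp only [phiMat, Matrix.of_apply, Fin.castSucc_inj, h1, h2, and_false, false_and, if_false,
    phase, and_comm]

lemma phiMat_castSucc_last (r : Fin m) :
    phiMat α φ ψ j r.castSucc (Fin.last m) =
      if r = j then Complex.exp (Complex.I * (ψ j : ℂ)) * (Real.sin (φ j) : ℂ) else 0 := by
  have h1 : Fin.last m ≠ j.castSucc := j.castSucc_ne_last.symm
  have h2 : r.castSucc ≠ Fin.last m := r.castSucc_ne_last
  simp only [phiMat, Matrix.of_apply, Fin.castSucc_inj, h1, h2, and_false, if_false, and_true]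

lemma phiMat_last_castSucc (s : Fin m) :
    phiMat α φ ψ j (Fin.last m) s.castSucc = if s = j then sinCoef φ ψ j else 0 := by
  have h1 : Fin.last m ≠ j.castSucc := j.castSucc_ne_last.symm
  have h2 : s.castSucc ≠ Fin.last m := s.castSucc_ne_last
  simp only [phiMat, Matrix.of_apply, Fin.castSucc_inj, h1, h2, h2.symm, and_false, false_and,
    if_false, true_and, sinCoef]

lemma phiMat_last_last :
    phiMat α φ ψ j (Fin.last m) (Fin.last m) = cosCoef α φ j := by
  have h1 : Fin.last m ≠ j.castSucc := j.castSucc_ne_last.symm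
  simp only [phiMat, Matrix.of_apply, h1, and_false, false_and, if_false, cosCoef, and_self,
    if_true]

lemma phase_mul_star (α : ℝ) (j : Fin m) : phase α j * star (phase α j) = 1 := by
  simp only [phase, Complex.star_def, ← Complex.exp_conj, ← Complex.exp_add, map_mul,
    Complex.conj_I, Complex.conj_ofReal]
  simp

lemma cosCoef_eq : cosCoef α φ j = star (phase α j) * (Real.cos (φ j) : ℂ) := by
  simp only [cosCoef, phase, Complex.star_def, ← Complex.exp_conj, map_mul,
    Complex.conj_I, Complex.conj_ofReal, neg_mul]

lemma exp_mul_star (x : ℝ) :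
    Complex.exp (Complex.I * (x : ℂ)) * star (Complex.exp (Complex.I * (x : ℂ))) = 1 := by
  simp only [Complex.star_def, ← Complex.exp_conj, ← Complex.exp_add, map_mul,
    Complex.conj_I, Complex.conj_ofReal]
  simp

lemma exp_neg_I_mul (x : ℝ) :
    Complex.exp (-(Complex.I * (x : ℂ))) = star (Complex.exp (Complex.I * (x : ℂ))) := by
  simp only [Complex.star_def, ← Complex.exp_conj, map_mul, Complex.conj_I, Complex.conj_ofReal,
    neg_mul]

lemma sinCoef_eq :
    sinCoef φ ψ j = -(star (Complex.exp (Complex.I * (ψ j : ℂ))) * (Real.sin (φ j) : ℂ)) := by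
  rw [sinCoef, exp_neg_I_mul]

lemma ofReal_cos_sq_add_sin_sq (x : ℝ) :
    (Real.cos x : ℂ) * (Real.cos x : ℂ) + (Real.sin x : ℂ) * (Real.sin x : ℂ) = 1 := by
  have := Real.cos_sq_add_sin_sq x
  rw [sq, sq] at this
  exact_mod_cast this

lemma phiMat_mem_unitaryGroup : phiMat α φ ψ j ∈ unitaryGroup (Fin (m + 1)) ℂ := by
  rw [Matrix.mem_unitaryGroup_iff]
  have hc := ofReal_cos_sq_add_sin_sq (φ j)
  have hp := phase_mul_star α j
  have hq := exp_mul_star (ψ j)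
  set p := phase α j with hp'
  set q := Complex.exp (Complex.I * (ψ j : ℂ)) with hq'
  ext r s
  rw [Matrix.mul_apply, Fin.sum_univ_castSucc]
  simp only [star_apply]
  refine Fin.lastCases ?_ (fun r => ?_) r <;> refine Fin.lastCases ?_ (fun s => ?_) s
  · simp only [phiMat_last_castSucc, phiMat_last_last, cosCoef_eq, sinCoef_eq, ← hp', ← hq',
      one_apply_eq]
    rw [Finset.sum_eq_single j (by intro b _ hb; simp [hb]) (by simp)]
    simp only [if_true, star_mul', star_neg, Complex.star_def, Complex.conj_ofReal,
      Complex.conj_conj]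
    simp only [Complex.star_def] at hp hq
    linear_combination hc + (Real.cos (φ j) : ℂ)^2 * hp + (Real.sin (φ j) : ℂ)^2 * hq
  · simp only [phiMat_last_castSucc, phiMat_last_last, phiMat_castSucc_castSucc,
      phiMat_castSucc_last, cosCoef_eq, sinCoef_eq, ← hp', ← hq']
    rw [one_apply_ne (s.castSucc_ne_last).symm,
      Finset.sum_eq_single j (by intro b _ hb; simp [hb]) (by simp)]
    by_cases hs : s = j
    · simp only [hs, if_true, star_mul', Complex.star_def,
        Complex.conj_ofReal, and_self]
      ring
    · simp [hs]
  · simp only [phiMat_last_castSucc, phiMat_last_last, phiMat_castSucc_castSucc,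
      phiMat_castSucc_last, cosCoef_eq, sinCoef_eq, ← hp', ← hq']
    rw [one_apply_ne (r.castSucc_ne_last),
      Finset.sum_eq_single j (by intro b _ hb; simp [hb]) (by simp)]
    by_cases hs : r = j
    · simp only [hs, if_true, star_mul', star_neg, Complex.star_def, Complex.conj_conj,
        Complex.conj_ofReal, and_self]
      ring
    · simp [hs]
  · simp only [phiMat_castSucc_castSucc, phiMat_castSucc_last, ← hp', ← hq']
    by_cases hr : r = j
    · rw [Finset.sum_eq_single j (by intro b _ hb; simp [hb, hr, Ne.symm hb]) (by simp)]
      by_cases hs : s = j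
      · rw [hs, hr, one_apply_eq]
        simp only [if_true, star_mul', Complex.star_def, Complex.conj_ofReal, and_self]
        simp only [Complex.star_def] at hp hq
        linear_combination hc + (Real.cos (φ j) : ℂ)^2 * hp + (Real.sin (φ j) : ℂ)^2 * hq
      · have : r.castSucc ≠ s.castSucc := by
          rw [Ne, Fin.castSucc_inj, hr]; exact Ne.symm hs
        simp [hs, one_apply_ne this]
    · rw [Finset.sum_eq_single r (by intro b _ hb; simp [hr, Ne.symm hb]) (by simp)]
      by_cases hs : s = r
      · rw [hs, one_apply_eq]
        simp [hr]
      · have : r.castSucc ≠ s.castSucc := by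
          rw [Ne, Fin.castSucc_inj]; exact Ne.symm hs
        simp [hs, hr, one_apply_ne this]

lemma mul_phiMat_castSucc (B : Matrix (Fin (m + 1)) (Fin (m + 1)) ℂ) (r : Fin (m + 1))
    (s : Fin m) :
    (B * phiMat α φ ψ j) r s.castSucc =
      if s = j then B r j.castSucc * (phase α j * (Real.cos (φ j) : ℂ)) +
        B r (Fin.last m) * sinCoef φ ψ j
      else B r s.castSucc := by
  rw [Matrix.mul_apply, Fin.sum_univ_castSucc]
  simp only [phiMat_castSucc_castSucc, phiMat_last_castSucc]
  rw [Finset.sum_eq_single s (by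
    intro b _ hb
    rw [if_neg, if_neg hb, mul_zero]
    rintro ⟨rfl, rfl⟩
    exact hb rfl) (by simp)]
  by_cases hs : s = j <;> simp [hs]

lemma mul_phiMat_last (B : Matrix (Fin (m + 1)) (Fin (m + 1)) ℂ) (r : Fin (m + 1)) :
    (B * phiMat α φ ψ j) r (Fin.last m) =
      B r j.castSucc * (Complex.exp (Complex.I * (ψ j : ℂ)) * (Real.sin (φ j) : ℂ)) +
        B r (Fin.last m) * cosCoef α φ j := by
  rw [Matrix.mul_apply, Fin.sum_univ_castSucc]
  simp only [phiMat_castSucc_last, phiMat_last_last]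
  rw [Finset.sum_eq_single j (by intro b _ hb; simp [hb]) (by simp)]
  simp

/-- The product of the first `t` factors of `prodH`. -/
def partialH (t : ℕ) (ht : t ≤ m) : Matrix (Fin (m + 1)) (Fin (m + 1)) ℂ :=
  (List.ofFn fun i : Fin t => phiMat α φ ψ (Fin.castLE ht i)).prod

lemma partialH_succ (t : ℕ) (ht : t + 1 ≤ m) :
    partialH α φ ψ (t + 1) ht =
      partialH α φ ψ t (Nat.le_of_succ_le ht) * phiMat α φ ψ ⟨t, ht⟩ := by
  rw [partialH, List.ofFn_succ', List.prod_concat]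
  rfl

/-- The t-th factor mixes only column t and the last column, so row r stays a unit vector until step
r. The two claims need a joint induction: entry (r, t) is updated from the last entry of row r, and
conversely. -/
lemma partialH_castSucc_castSucc_of_lt (t : ℕ) (ht : t ≤ m) (r s : Fin m) (h : s < r) :
    partialH α φ ψ t ht r.castSucc s.castSucc = 0 ∧
      (t ≤ r.val → partialH α φ ψ t ht r.castSucc (Fin.last m) = 0) := by
  induction t generalizing s with
  | zero => simp [partialH, h.ne', Fin.castSucc_ne_last]
  | succ t ih =>
    rw [partialH_succ, mul_phiMat_castSucc, mul_phiMat_last]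
    refine ⟨?_, fun h' => ?_⟩
    · split_ifs with hs
      · subst hs
        rw [(ih _ _ h).1, (ih _ _ h).2 (le_of_lt h)]
        simp
      · exact (ih _ _ h).1
    · rw [(ih _ ⟨t, ht⟩ h').1, (ih _ ⟨t, ht⟩ h').2 (by omega)]
      simp

lemma partialH_castSucc_last (t : ℕ) (ht : t ≤ m) (r : Fin m) (h : t ≤ r.val) :
    partialH α φ ψ t ht r.castSucc (Fin.last m) = 0 := by
  induction t with
  | zero => simp [partialH, Fin.castSucc_ne_last]
  | succ t ih =>
    rw [partialH_succ, mul_phiMat_last,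
      (partialH_castSucc_castSucc_of_lt α φ ψ t _ r ⟨t, ht⟩ h).1, ih _ (by omega)]
    simp

/-- Column r changes only at step r, and at that moment the last entry of row r is still zero, so
only the cosine term survives. -/
lemma partialH_diag (t : ℕ) (ht : t ≤ m) (r : Fin m) :
    partialH α φ ψ t ht r.castSucc r.castSucc =
      if r.val < t then phase α r * (Real.cos (φ r) : ℂ) else 1 := by
  induction t with
  | zero => simp [partialH]
  | succ t ih =>
    rw [partialH_succ, mul_phiMat_castSucc]
    split_ifs with h1 h2 h2
    · subst h1
      rw [ih, partialH_castSucc_last _ _ _ _ _ ⟨t, ht⟩ le_rfl]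
      simp
    · subst h1; simp at h2
    · rw [ih, if_pos]
      have : r.val ≠ t := fun h => h1 (Fin.ext h)
      omega
    · rw [ih, if_neg (by omega)]

/-- Columns not yet reached are still zero in the last row; therefore each step multiplies the
corner entry by one cosine coefficient and adds nothing. -/
lemma partialH_last_last (t : ℕ) (ht : t ≤ m) :
    partialH α φ ψ t ht (Fin.last m) (Fin.last m) =
      ∏ i : Fin t, cosCoef α φ (Fin.castLE ht i) ∧
    ∀ s : Fin m, t ≤ s.val → partialH α φ ψ t ht (Fin.last m) s.castSucc = 0 := by
  induction t with
  | zero => simp [partialH, (Fin.castSucc_ne_last _).symm]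
  | succ t ih =>
    rw [partialH_succ, mul_phiMat_last, (ih _).1, (ih (Nat.le_of_succ_le ht)).2 ⟨t, ht⟩ le_rfl,
      Fin.prod_univ_castSucc]
    refine ⟨by rw [zero_mul, zero_add]; rfl, fun s hs => ?_⟩
    rw [mul_phiMat_castSucc, if_neg (by rintro rfl; simp at hs), (ih _).2 s (by omega)]

lemma partialH_last_castSucc (t : ℕ) (ht : t ≤ m) (s : Fin m) (h : s.val < t) :
    partialH α φ ψ t ht (Fin.last m) s.castSucc =
      (∏ i : Fin s.val, cosCoef α φ (Fin.castLE s.isLt.le i)) * sinCoef φ ψ s := by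
  induction t with
  | zero => simp at h
  | succ t ih =>
    rw [partialH_succ, mul_phiMat_castSucc]
    split_ifs with h1
    · subst h1
      rw [(partialH_last_last α φ ψ t _).1, (partialH_last_last α φ ψ t _).2 _ le_rfl]
      simp
    · refine ih _ ?_
      have : s.val ≠ t := fun h => h1 (Fin.ext h)
      omega

lemma prodH_eq_partialH : prodH α φ ψ = partialH α φ ψ m le_rfl := rfl

lemma prodH_mem_unitaryGroup : prodH α φ ψ ∈ unitaryGroup (Fin (m + 1)) ℂ := by
  refine Submonoid.list_prod_mem _ fun A hA => ?_
  obtain ⟨j, rfl⟩ := (List.mem_ofFn' _ _).1 hA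
  exact phiMat_mem_unitaryGroup α φ ψ j

end phiMat

/-- The vector `(t₀, k₀ t₁, k₀ k₁ t₂, …, k₀ ⋯ k_{d-1})`. -/
def rowVec : (d : ℕ) → (Fin d → ℂ) → (Fin d → ℂ) → Fin (d + 1) → ℂ
  | 0, _, _ => fun _ => 1
  | d + 1, k, t => Fin.cons (t 0) (k 0 • rowVec d (fun i => k i.succ) fun i => t i.succ)

lemma rowVec_last (d : ℕ) (k t : Fin d → ℂ) : rowVec d k t (Fin.last d) = ∏ i, k i := by
  induction d with
  | zero => simp [rowVec]
  | succ d ih =>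
    rw [rowVec, ← Fin.succ_last, Fin.cons_succ, Pi.smul_apply, ih, Fin.prod_univ_succ, smul_eq_mul]

lemma rowVec_castSucc (d : ℕ) (k t : Fin d → ℂ) (s : Fin d) :
    rowVec d k t s.castSucc = (∏ i : Fin s.val, k (Fin.castLE s.isLt.le i)) * t s := by
  induction d with
  | zero => exact s.elim0
  | succ d ih =>
    refine Fin.cases ?_ (fun s => ?_) s
    · rw [rowVec, Fin.castSucc_zero, Fin.cons_zero]
      exact (one_mul _).symm
    · rw [rowVec, ← Fin.succ_castSucc, Fin.cons_succ, Pi.smul_apply, ih, smul_eq_mul, ← mul_assoc]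
      congr 1
      exact (Fin.prod_univ_succ (n := s.val)
        fun i : Fin (s.val + 1) => k (Fin.castLE s.succ.isLt.le i)).symm

lemma prodH_last {m : ℕ} (α : ℝ) (φ ψ : Fin m → ℝ) :
    prodH α φ ψ (Fin.last m) = rowVec m (cosCoef α φ) (sinCoef φ ψ) := by
  ext s
  rw [prodH_eq_partialH]
  refine Fin.lastCases ?_ (fun s => ?_) s
  · rw [(partialH_last_last α φ ψ m le_rfl).1, rowVec_last]
    rfl
  · rw [partialH_last_castSucc _ _ _ _ _ _ s.isLt, rowVec_castSucc]

/-! ### The block embedding A ↦ diag(A, 1). -/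

section diagOne

variable {m : ℕ}

lemma diagOne_castSucc_castSucc (A : Matrix (Fin m) (Fin m) ℂ) (i j : Fin m) :
    diagOne A i.castSucc j.castSucc = A i j := by
  simp only [diagOne, reindex_apply, submatrix_apply]
  have h (i : Fin m) : finSumFinEquiv.symm i.castSucc = Sum.inl i :=
    finSumFinEquiv_symm_apply_castAdd i
  rw [h, h, fromBlocks_apply₁₁]

lemma diagOne_castSucc_last (A : Matrix (Fin m) (Fin m) ℂ) (i : Fin m) :
    diagOne A i.castSucc (Fin.last m) = 0 := by
  simp only [diagOne, reindex_apply, submatrix_apply]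
  have h (i : Fin m) : finSumFinEquiv.symm i.castSucc = Sum.inl i :=
    finSumFinEquiv_symm_apply_castAdd i
  rw [h, finSumFinEquiv_symm_last, fromBlocks_apply₁₂, Matrix.zero_apply]

lemma diagOne_last_castSucc (A : Matrix (Fin m) (Fin m) ℂ) (i : Fin m) :
    diagOne A (Fin.last m) i.castSucc = 0 := by
  simp only [diagOne, reindex_apply, submatrix_apply]
  have h (i : Fin m) : finSumFinEquiv.symm i.castSucc = Sum.inl i :=
    finSumFinEquiv_symm_apply_castAdd i
  rw [h, finSumFinEquiv_symm_last, fromBlocks_apply₂₁, Matrix.zero_apply]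

lemma diagOne_last_last (A : Matrix (Fin m) (Fin m) ℂ) :
    diagOne A (Fin.last m) (Fin.last m) = 1 := by
  simp only [diagOne, reindex_apply, submatrix_apply]
  rw [finSumFinEquiv_symm_last, fromBlocks_apply₂₂, one_apply_eq]

lemma diagOne_mul (A B : Matrix (Fin m) (Fin m) ℂ) :
    diagOne (A * B) = diagOne A * diagOne B := by
  simp only [diagOne, reindex_apply]
  rw [submatrix_mul_equiv, fromBlocks_multiply]
  simp

lemma diagOne_one : diagOne (1 : Matrix (Fin m) (Fin m) ℂ) = 1 := by
  simp [diagOne, fromBlocks_one]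

lemma star_diagOne (A : Matrix (Fin m) (Fin m) ℂ) : star (diagOne A) = diagOne (star A) := by
  simp [diagOne, star_eq_conjTranspose, conjTranspose_submatrix, fromBlocks_conjTranspose]

lemma det_diagOne (A : Matrix (Fin m) (Fin m) ℂ) : (diagOne A).det = A.det := by
  rw [diagOne, det_reindex_self, det_fromBlocks_zero₂₁, det_one, mul_one]

lemma diagOne_injective : Function.Injective (diagOne (m := m)) := by
  intro A B h
  ext i j
  rw [← diagOne_castSucc_castSucc A, h, diagOne_castSucc_castSucc]

lemma diagOne_mem_unitaryGroup {A : Matrix (Fin m) (Fin m) ℂ} :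
    diagOne A ∈ unitaryGroup (Fin (m + 1)) ℂ ↔ A ∈ unitaryGroup (Fin m) ℂ := by
  rw [mem_unitaryGroup_iff, mem_unitaryGroup_iff, star_diagOne, ← diagOne_mul, ← diagOne_one,
    diagOne_injective.eq_iff]

lemma diagOne_mul_castSucc (A : Matrix (Fin m) (Fin m) ℂ)
    (B : Matrix (Fin (m + 1)) (Fin (m + 1)) ℂ) (i : Fin m) (s : Fin (m + 1)) :
    (diagOne A * B) i.castSucc s = ∑ x, A i x * B x.castSucc s := by
  rw [Matrix.mul_apply, Fin.sum_univ_castSucc]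
  simp [diagOne_castSucc_castSucc, diagOne_castSucc_last]

lemma diagOne_mul_last (A : Matrix (Fin m) (Fin m) ℂ)
    (B : Matrix (Fin (m + 1)) (Fin (m + 1)) ℂ) :
    (diagOne A * B) (Fin.last m) = B (Fin.last m) := by
  ext s
  rw [Matrix.mul_apply, Fin.sum_univ_castSucc]
  simp [diagOne_last_castSucc, diagOne_last_last]

/-- A unitary matrix whose last row is the last unit vector is block diagonal. -/
lemma exists_eq_diagOne {W : Matrix (Fin (m + 1)) (Fin (m + 1)) ℂ}
    (hW : W ∈ unitaryGroup (Fin (m + 1)) ℂ) (h : W (Fin.last m) = Pi.single (Fin.last m) 1) :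
    ∃ A ∈ unitaryGroup (Fin m) ℂ, W = diagOne A := by
  have hcol (i : Fin m) : W i.castSucc (Fin.last m) = 0 := by
    have := congrFun (congrFun (mem_unitaryGroup_iff.1 hW) i.castSucc) (Fin.last m)
    rw [Matrix.mul_apply, one_apply_ne i.castSucc_ne_last] at this
    simpa [star_apply, h, Pi.single_apply] using this
  have hWA : W = diagOne (W.submatrix Fin.castSucc Fin.castSucc) := by
    ext r s
    refine Fin.lastCases ?_ (fun r => ?_) r <;> refine Fin.lastCases ?_ (fun s => ?_) s
    · simp [h, diagOne_last_last]
    · simp [h, diagOne_last_castSucc, Fin.castSucc_ne_last]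
    · simp [hcol, diagOne_castSucc_last]
    · simp [diagOne_castSucc_castSucc]
  refine ⟨_, ?_, hWA⟩
  rw [hWA] at hW
  exact diagOne_mem_unitaryGroup.1 hW

end diagOne

/-! ### Unitarity, determinant and leading minors of V. -/

lemma V_mem_unitaryGroup (n : ℕ) (α : Fin n → ℝ) (φ ψ : PairAngles n) :
    V n α φ ψ ∈ unitaryGroup (Fin n) ℂ := by
  induction n with
  | zero => exact one_mem _
  | succ n ih =>
    cases n with
    | zero =>
      rw [mem_unitaryGroup_iff]
      ext i j
      have h := exp_mul_star (α 0)
      obtain rfl : i = 0 := Subsingleton.elim (α := Fin 1) _ _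
      obtain rfl : j = 0 := Subsingleton.elim (α := Fin 1) _ _
      simpa [V, Matrix.mul_apply, star_apply] using h
    | succ m =>
      exact mul_mem (diagOne_mem_unitaryGroup.2 (ih _ _ _)) (prodH_mem_unitaryGroup _ _ _)

/-- Φ - 1 is supported on two rows, so Φ = 1 + AB with A of width 2. The identity det(1 + AB) =
det(1 + BA) then reduces the determinant to the 2 × 2 block in the rows and columns j and last. -/
lemma det_phiMat {m : ℕ} (α : ℝ) (φ ψ : Fin m → ℝ) (j : Fin m) : (phiMat α φ ψ j).det = 1 := by
  let e : Fin 2 → Fin (m + 1) := ![j.castSucc, Fin.last m]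
  let A : Matrix (Fin (m + 1)) (Fin 2) ℂ := Matrix.of fun r x => if r = e x then 1 else 0
  let B : Matrix (Fin 2) (Fin (m + 1)) ℂ := (phiMat α φ ψ j - 1).submatrix e id
  have hne : j.castSucc ≠ Fin.last m := j.castSucc_ne_last
  have hAB : phiMat α φ ψ j = 1 + A * B := by
    ext r s
    rw [Matrix.add_apply, Matrix.mul_apply, Fin.sum_univ_two]
    simp only [A, B, e, Matrix.of_apply, submatrix_apply, Matrix.sub_apply, id,
      Matrix.cons_val_zero, Matrix.cons_val_one]
    by_cases h1 : r = j.castSucc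
    · subst h1; simp [hne]
    by_cases h2 : r = Fin.last m
    · subst h2; simp [h1]
    · simp only [phiMat, Matrix.of_apply, h1, h2, false_and, if_false, Matrix.one_apply]
      simp
  have hBA : 1 + B * A = (phiMat α φ ψ j).submatrix e e := by
    have he : Function.Injective e := by
      intro x y h
      fin_cases x <;> fin_cases y <;> simp_all [e, hne.symm]
    ext x y
    rw [Matrix.add_apply, Matrix.mul_apply]
    simp [A, B, Matrix.one_apply, he.eq_iff]
  rw [hAB, det_one_add_mul_comm, hBA, det_fin_two]
  simp only [submatrix_apply, e, Matrix.cons_val_zero, Matrix.cons_val_one,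
    phiMat_castSucc_castSucc, phiMat_castSucc_last, phiMat_last_castSucc, phiMat_last_last,
    cosCoef_eq, sinCoef_eq, and_self, if_true]
  have hc := ofReal_cos_sq_add_sin_sq (φ j)
  have hp := phase_mul_star α j
  have hq := exp_mul_star (ψ j)
  linear_combination hc + (Real.cos (φ j) : ℂ)^2 * hp + (Real.sin (φ j) : ℂ)^2 * hq

lemma det_prodH {m : ℕ} (α : ℝ) (φ ψ : Fin m → ℝ) : (prodH α φ ψ).det = 1 := by
  rw [prodH, ← Matrix.coe_detMonoidHom, map_list_prod]
  refine List.prod_eq_one fun x hx => ?_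
  obtain ⟨A, hA, rfl⟩ := List.mem_map.1 hx
  obtain ⟨j, rfl⟩ := (List.mem_ofFn' _ _).1 hA
  exact det_phiMat α φ ψ j

lemma det_V (n : ℕ) (α : Fin (n + 1) → ℝ) (φ ψ : PairAngles (n + 1)) :
    (V (n + 1) α φ ψ).det = Complex.exp (Complex.I * (α 0 : ℂ)) := by
  induction n with
  | zero =>
    rw [V]
    exact det_fin_one _
  | succ m ih =>
    rw [V, det_mul, det_diagOne, det_prodH, mul_one, ih]
    rfl

lemma prod_phase {m : ℕ} (α : ℝ) (l : ℕ) (h1 : 1 ≤ l) (hl : l ≤ m) :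
    ∏ j : Fin l, phase α (Fin.castLE hl j) = Complex.exp (Complex.I * (α : ℂ)) := by
  obtain ⟨l, rfl⟩ := Nat.exists_eq_add_of_le' h1
  rw [Fin.prod_univ_succ, Finset.prod_eq_one, mul_one]
  · simp [phase]
  · intro j _
    simp [phase]

/-- The upper left m × m block of H is upper triangular, so the leading l × l block of diag(A, 1) H
is the product of the leading blocks of A and H. The phase of α enters once, through the first
diagonal entry; this needs l ≥ 1. -/
lemma det_leading_diagOne_mul_prodH {m : ℕ} (A : Matrix (Fin m) (Fin m) ℂ) (α : ℝ)
    (φ ψ : Fin m → ℝ) (l : ℕ) (h1 : 1 ≤ l) (hl : l ≤ m) :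
    (leading (diagOne A * prodH α φ ψ) l (hl.trans m.le_succ)).det =
      (leading A l hl).det * (Complex.exp (Complex.I * (α : ℂ)) *
        ((∏ j : Fin l, Real.cos (φ (Fin.castLE hl j)) : ℝ) : ℂ)) := by
  have hle (i : Fin l) : Fin.castLE (hl.trans m.le_succ) i = (Fin.castLE hl i).castSucc := rfl
  let T : Matrix (Fin l) (Fin l) ℂ := Matrix.of fun i j =>
    prodH α φ ψ (Fin.castLE hl i).castSucc (Fin.castLE hl j).castSucc
  have hT : T.det = Complex.exp (Complex.I * (α : ℂ)) *
        ((∏ j : Fin l, Real.cos (φ (Fin.castLE hl j)) : ℝ) : ℂ) := by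
    rw [det_of_isUpperTriangular]
    · simp only [T, Matrix.of_apply, prodH_eq_partialH, partialH_diag, Fin.is_lt, if_true]
      rw [Finset.prod_mul_distrib, prod_phase α l h1 hl]
      push_cast
      rfl
    · intro i j hij
      exact (partialH_castSucc_castSucc_of_lt α φ ψ m le_rfl (Fin.castLE hl i)
        (Fin.castLE hl j) hij).1
  rw [← hT, ← det_mul]
  congr 1
  ext i j
  rw [leading, submatrix_apply, hle, hle, diagOne_mul_castSucc, Matrix.mul_apply]
  refine (Fintype.sum_of_injective (Fin.castLE hl) (Fin.castLE_injective hl) _ _ ?_ ?_).symm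
  · intro x hx
    have hxl : l ≤ x.val := by
      by_contra! h
      exact hx ⟨⟨x.val, h⟩, rfl⟩
    rw [prodH_eq_partialH, (partialH_castSucc_castSucc_of_lt α φ ψ m le_rfl x
        (Fin.castLE hl j) (show (Fin.castLE hl j).val < x.val from lt_of_lt_of_le j.isLt hxl)).1,
      mul_zero]
  · intro x
    rfl

lemma radius_self {n : ℕ} (φ : PairAngles n) : radius φ n = 1 :=
  Finset.prod_eq_one fun k _ => if_neg (by omega)

lemma phaseArg_self {n : ℕ} (hn : 0 < n) (α : Fin n → ℝ) : phaseArg hn α n = α ⟨0, hn⟩ := by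
  rw [phaseArg, Finset.sum_eq_zero fun k _ => if_neg (by omega), add_zero]

lemma radius_succ {n : ℕ} (φ : PairAngles (n + 1)) (l : ℕ) (hl : l ≤ n) :
    radius φ l = radius (fun k => φ k.castSucc) l *
      ∏ j : Fin l, Real.cos (φ (Fin.last n) (Fin.castLE hl j)) := by
  rw [radius, Fin.prod_univ_castSucc, if_pos (show l ≤ (Fin.last n).val from hl)]
  congr 1
  refine (Fintype.prod_of_injective (Fin.castLE hl) (Fin.castLE_injective hl) _ _ ?_ ?_).symm
  · intro x hx
    refine if_neg fun h => hx ⟨⟨x.val, h⟩, rfl⟩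
  · intro x
    rw [if_pos (by simp)]

lemma phaseArg_succ {n : ℕ} (hn : 0 < n) (α : Fin (n + 1) → ℝ) (l : ℕ) (hl : l ≤ n) :
    phaseArg n.succ_pos α l = phaseArg hn (fun k => α k.castSucc) l + α (Fin.last n) := by
  rw [phaseArg, phaseArg, Fin.sum_univ_castSucc, Fin.val_last, if_pos hl, add_assoc]
  rfl

/-- The leading principal minors of `V`. -/
lemma det_leading_V (n : ℕ) (hn : 0 < n) (α : Fin n → ℝ) (φ ψ : PairAngles n) (l : ℕ)
    (h1 : 1 ≤ l) (hl : l ≤ n) :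
    (leading (V n α φ ψ) l hl).det =
      (radius φ l : ℂ) * Complex.exp (Complex.I * (phaseArg hn α l : ℂ)) := by
  induction n with
  | zero => omega
  | succ n ih =>
    rcases hl.eq_or_lt with rfl | hlt
    · rw [radius_self, phaseArg_self]
      have : leading (V (n + 1) α φ ψ) (n + 1) hl = V (n + 1) α φ ψ := by
        ext i j
        rfl
      rw [this, det_V, Complex.ofReal_one, one_mul]
      rfl
    · cases n with
      | zero => omega
      | succ m =>
        have hl' : l ≤ m + 1 := Nat.le_of_lt_succ hlt
        rw [V, det_leading_diagOne_mul_prodH _ _ _ _ l h1 hl', ih m.succ_pos _ _ _ hl',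
          radius_succ φ l hl', phaseArg_succ m.succ_pos α l hl']
        push_cast
        rw [mul_add, Complex.exp_add]
        ring

/-! ### LU decompositions. -/

section LU

variable {n : ℕ} {A L U : Matrix (Fin n) (Fin n) ℂ}

/-- Since L is lower triangular, rows below l of U do not contribute to the leading l × l block of
LU, so leading blocks multiply. -/
lemma IsLU.det_leading (h : IsLU A L U) (l : ℕ) (hl : l ≤ n) :
    (leading A l hl).det = ∏ i : Fin l, U (Fin.castLE hl i) (Fin.castLE hl i) := by
  have hA : leading A l hl = leading L l hl * leading U l hl := by
    ext i j
    rw [leading, submatrix_apply, h.eq, Matrix.mul_apply, Matrix.mul_apply]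
    refine (Fintype.sum_of_injective (Fin.castLE hl) (Fin.castLE_injective hl) _ _ ?_ ?_).symm
    · intro x hx
      have hxl : l ≤ x.val := by
        by_contra! h
        exact hx ⟨⟨x.val, h⟩, rfl⟩
      rw [h.lower _ _ (show (Fin.castLE hl i).val < x.val from lt_of_lt_of_le i.isLt hxl), zero_mul]
    · intro x
      rfl
  rw [hA, det_mul, det_of_isLowerTriangular (M := leading L l hl) fun i j hij => h.lower _ _ hij,
    det_of_isUpperTriangular (M := leading U l hl) fun i j hij => h.upper _ _ hij]
  simp only [leading, submatrix_apply, h.unit, Finset.prod_const_one, one_mul]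

lemma IsLU.det (h : IsLU A L U) : A.det = ∏ i, U i i :=
  h.det_leading n le_rfl

end LU

/-- `cos φ_{j,k}` for `j < k`, and `1` otherwise. -/
def cosOrOne {n : ℕ} (φ : PairAngles n) (k : Fin n) (j : ℕ) : ℝ :=
  if h : j < k.val then Real.cos (φ k ⟨j, h⟩) else 1

lemma radius_eq {n : ℕ} (φ : PairAngles n) (l : ℕ) :
    radius φ l = ∏ k : Fin n, if l ≤ k.val then ∏ j ∈ Finset.range l, cosOrOne φ k j else 1 := by
  refine Finset.prod_congr rfl fun k _ => ?_
  split_ifs with h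
  · rw [Finset.prod_range]
    refine (Fintype.prod_of_injective (Fin.castLE h) (Fin.castLE_injective h) _ _ ?_ ?_).symm
    · intro x hx
      exact if_neg fun h => hx ⟨⟨x.val, h⟩, rfl⟩
    · intro x
      rw [if_pos (by simp), cosOrOne, dif_pos (lt_of_lt_of_le x.isLt h)]
      rfl
  · rfl

/-- Passing from l to l + 1, every k > l gains the factor cos φ_{l,k}, while k = l leaves the
product together with its factors cos φ_{j,l}. The form without division holds even when cosines
vanish. -/
lemma radius_succ_mul {n : ℕ} (φ : PairAngles n) (l : Fin n) :
    radius φ (l.val + 1) * ∏ j : Fin l, Real.cos (φ l j) =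
      radius φ l.val * ∏ k : {k : Fin n // l < k}, Real.cos (φ k.1 ⟨l, k.2⟩) := by
  have h1 : ∏ j : Fin l, Real.cos (φ l j) = ∏ j ∈ Finset.range l, cosOrOne φ l j := by
    rw [Finset.prod_range]
    exact Finset.prod_congr rfl fun j _ => by rw [cosOrOne, dif_pos j.isLt]
  have h2 : ∏ k : {k : Fin n // l < k}, Real.cos (φ k.1 ⟨l, k.2⟩) =
      ∏ k : Fin n, cosOrOne φ k l := by
    refine Fintype.prod_of_injective Subtype.val Subtype.val_injective _ _ ?_ ?_
    · intro x hx
      exact dif_neg fun h => hx ⟨⟨x, h⟩, rfl⟩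
    · intro x
      rw [cosOrOne, dif_pos]
  have h3 : ∏ j ∈ Finset.range l, cosOrOne φ l j =
      ∏ k : Fin n, if k = l then ∏ j ∈ Finset.range l, cosOrOne φ k j else 1 := by
    rw [Finset.prod_ite_eq' Finset.univ l, if_pos (Finset.mem_univ _)]
  rw [h1, h2, radius_eq, radius_eq, h3, ← Finset.prod_mul_distrib, ← Finset.prod_mul_distrib]
  refine Finset.prod_congr rfl fun k _ => ?_
  rcases lt_trichotomy k l with h | h | h
  · have h' : k.val < l.val := h
    rw [if_neg (by omega), if_neg h.ne, if_neg (by omega), cosOrOne, dif_neg (by omega)]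
  · subst h
    simp [cosOrOne]
  · have h' : l.val < k.val := h
    rw [if_pos (by omega), if_neg h.ne', if_pos (by omega), Finset.prod_range_succ, mul_one]

lemma radius_nonneg {n : ℕ} {α : Fin n → ℝ} {φ ψ : PairAngles n} (h : InRange α φ ψ) (l : ℕ) :
    0 ≤ radius φ l := by
  have hcos (k : Fin n) (j : Fin k) : 0 ≤ Real.cos (φ k j) :=
    Real.cos_nonneg_of_mem_Icc ⟨by linarith [(h.phi k j).1, Real.pi_pos], (h.phi k j).2⟩
  refine Finset.prod_nonneg fun k _ => ?_
  split_ifs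
  · refine Finset.prod_nonneg fun j _ => ?_
    split_ifs
    exacts [hcos k j, zero_le_one]
  · exact zero_le_one

lemma phaseArg_eq_add {n : ℕ} (hn : 0 < n) (α : Fin n → ℝ) (l : Fin n) :
    phaseArg hn α l.val = phaseArg hn α (l.val + 1) + α l := by
  have : α l = ∑ j : Fin n, if j = l then α j else 0 := by simp
  rw [phaseArg, phaseArg, this, add_assoc, ← Finset.sum_add_distrib]
  congr 1
  refine Finset.sum_congr rfl fun k _ => ?_
  rcases lt_trichotomy k l with h | h | h
  · have h' : k.val < l.val := h
    rw [if_neg (by omega), if_neg (by omega), if_neg h.ne, add_zero]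
  · subst h
    simp
  · have h' : l.val < k.val := h
    rw [if_pos (by omega), if_pos (by omega), if_neg h.ne', add_zero]

section LUofV

variable {n : ℕ} {α : Fin n → ℝ} {φ ψ : PairAngles n} {L U : Matrix (Fin n) (Fin n) ℂ}

lemma IsLU.prod_diag (hn : 0 < n) (hLU : IsLU (V n α φ ψ) L U) (l : ℕ) (h1 : 1 ≤ l) (hl : l ≤ n) :
    ∏ i : Fin l, U (Fin.castLE hl i) (Fin.castLE hl i) =
      (radius φ l : ℂ) * Complex.exp (Complex.I * (phaseArg hn α l : ℂ)) := by
  rw [← hLU.det_leading, det_leading_V n hn α φ ψ l h1 hl]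

/-- The product of the diagonal of U is det V, which lies on the unit circle. This is what makes the
radii strictly positive as soon as an LU decomposition exists. -/
lemma IsLU.diag_ne_zero (hn : 0 < n) (hLU : IsLU (V n α φ ψ) L U) (i : Fin n) : U i i ≠ 0 := by
  have h : (V n α φ ψ).det ≠ 0 := by
    obtain ⟨m, rfl⟩ := Nat.exists_eq_add_of_le' hn
    rw [det_V]
    exact Complex.exp_ne_zero _
  rw [hLU.det] at h
  exact Finset.prod_ne_zero_iff.1 h i (Finset.mem_univ _)

lemma IsLU.radius_ne_zero (hn : 0 < n) (hLU : IsLU (V n α φ ψ) L U) (l : ℕ) (h1 : 1 ≤ l)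
    (hl : l ≤ n) : radius φ l ≠ 0 := by
  intro h
  have := hLU.prod_diag hn l h1 hl
  rw [h, Complex.ofReal_zero, zero_mul] at this
  exact Finset.prod_ne_zero_iff.2 (fun i _ => hLU.diag_ne_zero hn _) this

lemma IsLU.radius_pos (hn : 0 < n) (hr : InRange α φ ψ) (hLU : IsLU (V n α φ ψ) L U) (l : ℕ)
    (h1 : 1 ≤ l) (hl : l ≤ n) : 0 < radius φ l :=
  lt_of_le_of_ne (radius_nonneg hr l) (hLU.radius_ne_zero hn l h1 hl).symm

/-- A diagonal entry is the quotient of two consecutive leading minors. The first one is a minor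
itself, and it carries the sum of all the α; this is why `uDiag` has two cases. -/
lemma IsLU.diag_eq (hn : 0 < n) (hLU : IsLU (V n α φ ψ) L U) (l : Fin n) :
    U l l = uDiag α φ l := by
  have hrad := radius_succ_mul φ l
  have hsucc := hLU.prod_diag hn (l.val + 1) (by omega) l.isLt
  rw [Fin.prod_univ_castSucc] at hsucc
  have hlast : Fin.castLE l.isLt (Fin.last l.val) = l := rfl
  rw [hlast] at hsucc
  rw [uDiag]
  split_ifs with h0
  · have hr0 : radius φ l.val = 1 := by
      rw [radius_eq, h0]
      simp
    have hp0 : phaseArg hn α (l.val + 1) = ∑ j, α j := by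
      have h := phaseArg_eq_add hn α l
      have h' : phaseArg hn α l.val = α ⟨0, hn⟩ + ∑ j, α j := by
        rw [phaseArg, h0]; simp
      have h'' : (⟨0, hn⟩ : Fin n) = l := Fin.ext h0.symm
      rw [h', h''] at h
      linarith
    have e1 : ∏ j : Fin l, Real.cos (φ l j) = 1 := by
      have : IsEmpty (Fin l.val) := by rw [h0]; infer_instance
      exact Finset.prod_of_isEmpty _
    have e2 : ∏ i : Fin l.val, U (Fin.castLE l.isLt i.castSucc) (Fin.castLE l.isLt i.castSucc)
        = 1 := by
      have : IsEmpty (Fin l.val) := by rw [h0]; infer_instance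
      exact Finset.prod_of_isEmpty _
    rw [e2, one_mul, hp0] at hsucc
    rw [e1, hr0, mul_one, one_mul] at hrad
    rw [hsucc, hrad, mul_comm]
  · have hl := hLU.prod_diag hn l.val (by omega) l.isLt.le
    have hl' : ∏ i : Fin l.val, U (Fin.castLE l.isLt i.castSucc) (Fin.castLE l.isLt i.castSucc) =
        (radius φ l.val : ℂ) * Complex.exp (Complex.I * (phaseArg hn α l.val : ℂ)) := hl
    rw [hl', phaseArg_eq_add hn α l] at hsucc
    have r1 : (radius φ l.val : ℂ) ≠ 0 := by
      exact_mod_cast hLU.radius_ne_zero hn l.val (by omega) l.isLt.le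
    have r2 : radius φ (l.val + 1) ≠ 0 := hLU.radius_ne_zero hn _ (by omega) l.isLt
    have r3 : ∏ j : Fin l, Real.cos (φ l j) ≠ 0 := by
      intro h
      have r1' := hLU.radius_ne_zero hn l.val (by omega) l.isLt.le
      rw [h, mul_zero] at hrad
      have hz : ∏ k : {k : Fin n // l < k}, Real.cos (φ k.1 ⟨l, k.2⟩) = 0 :=
        (mul_eq_zero.1 hrad.symm).resolve_left r1'
      -- These cosines are exactly the factor with k = l of `radius φ l`, which is nonzero.
      have hlz : ∏ j : Fin l, Real.cos (φ l j) ≠ 0 := by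
        rw [radius_eq] at r1'
        have := Finset.prod_ne_zero_iff.1 r1' l (Finset.mem_univ _)
        rw [if_pos le_rfl, Finset.prod_range] at this
        convert this using 2 with j
        rw [cosOrOne, dif_pos j.isLt]
      exact hlz h
    have r4 : ((∏ j : Fin l, Real.cos (φ l j) : ℝ) : ℂ) ≠ 0 := by exact_mod_cast r3
    have hradC : (radius φ (l.val + 1) : ℂ) * ((∏ j : Fin l, Real.cos (φ l j) : ℝ) : ℂ) =
        (radius φ l.val : ℂ) *
          ((∏ k : {k : Fin n // l < k}, Real.cos (φ k.1 ⟨l, k.2⟩) : ℝ) : ℂ) := by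
      exact_mod_cast hrad
    rw [Complex.ofReal_add, mul_add, Complex.exp_add] at hsucc
    have hE := Complex.exp_ne_zero (Complex.I * (phaseArg hn α (l.val + 1) : ℂ))
    have hF := Complex.exp_ne_zero (Complex.I * (α l : ℂ))
    rw [Complex.exp_neg, Complex.ofReal_div]
    field_simp
    refine mul_left_cancel₀ (mul_ne_zero r1 hE) ?_
    linear_combination ((∏ j : Fin l, Real.cos (φ l j) : ℝ) : ℂ) * hsucc +
      Complex.exp (Complex.I * (phaseArg hn α (l.val + 1) : ℂ)) * hradC

end LUofV

/-! ### Existence of the angles: spherical coordinates. -/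

/-- `Complex.arg` takes values in (-π, π]; the minus sign in the exponent turns this into the
required interval [-π, π). -/
lemma exists_angle (z : ℂ) :
    ∃ θ ∈ Set.Ico (-Real.pi) Real.pi, z = (‖z‖ : ℂ) * Complex.exp (-(Complex.I * (θ : ℂ))) := by
  refine ⟨-Complex.arg z, ⟨by linarith [Complex.arg_le_pi z], by linarith [Complex.neg_pi_lt_arg z]⟩,
    ?_⟩
  conv_lhs => rw [← Complex.norm_mul_exp_arg_mul_I z]
  congr 2
  push_cast
  ring

lemma norm_exp_neg_I_mul (x : ℝ) : ‖Complex.exp (-(Complex.I * (x : ℂ)))‖ = 1 := by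
  rw [exp_neg_I_mul, norm_star, mul_comm, Complex.norm_exp_ofReal_mul_I]

lemma angle_eq_of_exp_eq {θ θ' : ℝ} (h : θ ∈ Set.Ico (-Real.pi) Real.pi)
    (h' : θ' ∈ Set.Ico (-Real.pi) Real.pi)
    (he : Complex.exp (-(Complex.I * (θ : ℂ))) = Complex.exp (-(Complex.I * (θ' : ℂ)))) :
    θ = θ' := by
  have key (x : ℝ) (hx : x ∈ Set.Ico (-Real.pi) Real.pi) :
      Complex.arg (Complex.exp (-(Complex.I * (x : ℂ)))) = -x := by
    have : -(Complex.I * (x : ℂ)) = ((-x : ℝ) : ℂ) * Complex.I := by push_cast; ring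
    rw [this, Complex.arg_exp_mul_I]
    rw [toIocMod_eq_self]
    constructor <;> linarith [hx.1, hx.2]
  have := congrArg Complex.arg he
  rw [key θ h, key θ' h'] at this
  linarith

/-- The real cosines as complex numbers. -/
def cosVec {d : ℕ} (φ : Fin d → ℝ) (i : Fin d) : ℂ := (Real.cos (φ i) : ℂ)

lemma cosCoef_zero {d : ℕ} (α : ℝ) (φ : Fin (d + 1) → ℝ) :
    cosCoef α φ 0 = Complex.exp (-(Complex.I * (α : ℂ))) * (Real.cos (φ 0) : ℂ) := by
  simp [cosCoef]

lemma cosCoef_succ {d : ℕ} (α : ℝ) (φ : Fin (d + 1) → ℝ) :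
    (fun i : Fin d => cosCoef α φ i.succ) = cosVec fun i => φ i.succ := by
  ext i
  simp [cosCoef, cosVec]

/-- The last row of `H`, split into its first entry and the rest. -/
lemma prodH_last_eq_cons {d : ℕ} (α : ℝ) (φ ψ : Fin (d + 1) → ℝ) :
    prodH α φ ψ (Fin.last (d + 1)) = Fin.cons (sinCoef φ ψ 0)
      ((Real.cos (φ 0) : ℂ) • Complex.exp (-(Complex.I * (α : ℂ))) •
        rowVec d (cosVec fun i => φ i.succ) (sinCoef (fun i => φ i.succ) fun i => ψ i.succ)) := by
  rw [prodH_last, rowVec, cosCoef_succ, cosCoef_zero, smul_smul, mul_comm]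
  rfl

/-- Split off the first coordinate: sin φ₀ is its modulus, cos φ₀ is the norm of the tail, and the
normalised tail is described by induction. Only the modulus of the first coordinate is treated,
because its phase is handled differently for `rowVec` with a global phase and for the last row of H.
-/
lemma exists_tail_eq {d : ℕ}
    (ih : ∀ w : Fin (d + 1) → ℂ, ∑ i, ‖w i‖ ^ 2 = 1 → ∃ (α : ℝ) (φ ψ : Fin d → ℝ),
      α ∈ Set.Ico (-Real.pi) Real.pi ∧ (∀ j, φ j ∈ Set.Icc 0 (Real.pi / 2)) ∧
      (∀ j, ψ j ∈ Set.Ico (-Real.pi) Real.pi) ∧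
      w = Complex.exp (-(Complex.I * (α : ℂ))) • rowVec d (cosVec φ) (sinCoef φ ψ))
    (w : Fin (d + 2) → ℂ) (hw : ∑ i, ‖w i‖ ^ 2 = 1) :
    ∃ (α φ₀ : ℝ) (φ ψ : Fin d → ℝ),
      α ∈ Set.Ico (-Real.pi) Real.pi ∧ φ₀ ∈ Set.Icc 0 (Real.pi / 2) ∧
      (∀ j, φ j ∈ Set.Icc 0 (Real.pi / 2)) ∧
      (∀ j, ψ j ∈ Set.Ico (-Real.pi) Real.pi) ∧ ‖w 0‖ = Real.sin φ₀ ∧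
      (fun i => w (Fin.succ i)) = (Real.cos φ₀ : ℂ) • Complex.exp (-(Complex.I * (α : ℂ))) •
        rowVec d (cosVec φ) (sinCoef φ ψ) := by
  rw [Fin.sum_univ_succ] at hw
  set c2 := ∑ i : Fin (d + 1), ‖w i.succ‖ ^ 2 with hc2
  have hc2_nonneg : 0 ≤ c2 := Finset.sum_nonneg fun _ _ => by positivity
  have hs1 : ‖w 0‖ ≤ 1 := by
    have := norm_nonneg (w 0)
    nlinarith
  have hsin : Real.sin (Real.arcsin ‖w 0‖) = ‖w 0‖ :=
    Real.sin_arcsin (by linarith [norm_nonneg (w 0)]) hs1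
  have hcos : Real.cos (Real.arcsin ‖w 0‖) = Real.sqrt c2 := by
    rw [Real.cos_arcsin]
    congr 1
    linarith
  have hφ₀ : Real.arcsin ‖w 0‖ ∈ Set.Icc 0 (Real.pi / 2) :=
    ⟨Real.arcsin_nonneg.2 (norm_nonneg _), Real.arcsin_le_pi_div_two _⟩
  by_cases h0 : c2 = 0
  -- If the tail vanishes, then cos φ₀ = 0 and the remaining angles are arbitrary; any unit vector
  -- supplies admissible ones.
  · obtain ⟨α, φ, ψ, hα, hφ, hψ, -⟩ := ih (Pi.single 0 1) (by
      rw [Finset.sum_eq_single 0] <;> simp +contextual)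
    refine ⟨α, _, φ, ψ, hα, hφ₀, hφ, hψ, hsin.symm, ?_⟩
    rw [hcos, h0, Real.sqrt_zero, Complex.ofReal_zero, zero_smul]
    ext i
    have := (Finset.sum_eq_zero_iff_of_nonneg (fun _ _ => by positivity)).1 h0 i
      (Finset.mem_univ _)
    simpa using this
  · have hc : Real.sqrt c2 ≠ 0 := (Real.sqrt_pos.2 (lt_of_le_of_ne hc2_nonneg (Ne.symm h0))).ne'
    obtain ⟨α, φ, ψ, hα, hφ, hψ, h⟩ := ih (fun i => ((Real.sqrt c2 : ℝ) : ℂ)⁻¹ * w i.succ) (by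
      simp only [norm_mul, norm_inv, Complex.norm_real, mul_pow, ← Finset.mul_sum, ← hc2,
        inv_pow, Real.norm_eq_abs, sq_abs]
      rw [Real.sq_sqrt hc2_nonneg, inv_mul_cancel₀ h0])
    refine ⟨α, _, φ, ψ, hα, hφ₀, hφ, hψ, hsin.symm, ?_⟩
    rw [← h, hcos]
    ext i
    simp only [Pi.smul_apply, smul_eq_mul]
    rw [mul_inv_cancel_left₀]
    exact_mod_cast hc

lemma exists_sinCoef_eq (z : ℂ) (φ₀ : ℝ) (h : ‖z‖ = Real.sin φ₀) :
    ∃ ψ₀ ∈ Set.Ico (-Real.pi) Real.pi,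
      z = -(Complex.exp (-(Complex.I * (ψ₀ : ℂ))) * (Real.sin φ₀ : ℂ)) := by
  obtain ⟨ψ, hψ, hz⟩ := exists_angle (-z)
  refine ⟨ψ, hψ, ?_⟩
  rw [norm_neg, h] at hz
  rw [mul_comm, ← hz, neg_neg]

/-- Spherical coordinates on the unit sphere of `ℂ^{d+1}`. -/
lemma exists_rowVec_eq (d : ℕ) (w : Fin (d + 1) → ℂ) (hw : ∑ i, ‖w i‖ ^ 2 = 1) :
    ∃ (α : ℝ) (φ ψ : Fin d → ℝ),
      α ∈ Set.Ico (-Real.pi) Real.pi ∧ (∀ j, φ j ∈ Set.Icc 0 (Real.pi / 2)) ∧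
      (∀ j, ψ j ∈ Set.Ico (-Real.pi) Real.pi) ∧
      w = Complex.exp (-(Complex.I * (α : ℂ))) • rowVec d (cosVec φ) (sinCoef φ ψ) := by
  induction d with
  | zero =>
    obtain ⟨α, hα, h⟩ := exists_angle (w 0)
    refine ⟨α, 0, 0, hα, fun j => j.elim0, fun j => j.elim0, ?_⟩
    have h1 : ‖w 0‖ = 1 := by
      rw [Fin.sum_univ_one] at hw
      nlinarith [norm_nonneg (w 0)]
    rw [h1, Complex.ofReal_one, one_mul] at h
    ext i
    obtain rfl : i = 0 := Subsingleton.elim (α := Fin 1) _ _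
    simpa [rowVec] using h
  | succ d ih =>
    obtain ⟨α, φ₀, φ, ψ, hα, hφ₀, hφ, hψ, hn, ht⟩ := exists_tail_eq ih w hw
    have hE : ‖Complex.exp (Complex.I * (α : ℂ))‖ = 1 := by
      rw [mul_comm, Complex.norm_exp_ofReal_mul_I]
    -- The global phase e^{-iα} also multiplies the first coordinate, so it is undone before ψ₀ is
    -- chosen.
    obtain ⟨ψ₀, hψ₀, hz⟩ := exists_sinCoef_eq (Complex.exp (Complex.I * (α : ℂ)) * w 0) φ₀
      (by rw [norm_mul, hE, one_mul, hn])
    refine ⟨α, Fin.cons φ₀ φ, Fin.cons ψ₀ ψ, hα, Fin.cases hφ₀ hφ, Fin.cases hψ₀ hψ, ?_⟩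
    ext i
    refine Fin.cases ?_ (fun i => ?_) i
    · simp only [rowVec, sinCoef, Pi.smul_apply, Fin.cons_zero, smul_eq_mul]
      rw [← hz, ← mul_assoc, ← Complex.exp_add]
      simp
    · have := congrFun ht i
      simp only [rowVec, Pi.smul_apply, Fin.cons_zero, Fin.cons_succ, smul_eq_mul, cosVec,
        sinCoef] at this ⊢
      rw [this]
      ring_nf
      rfl

lemma exists_prodH_last_eq {d : ℕ} (w : Fin (d + 2) → ℂ) (hw : ∑ i, ‖w i‖ ^ 2 = 1) :
    ∃ (α : ℝ) (φ ψ : Fin (d + 1) → ℝ),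
      α ∈ Set.Ico (-Real.pi) Real.pi ∧ (∀ j, φ j ∈ Set.Icc 0 (Real.pi / 2)) ∧
      (∀ j, ψ j ∈ Set.Ico (-Real.pi) Real.pi) ∧ prodH α φ ψ (Fin.last (d + 1)) = w := by
  obtain ⟨α, φ₀, φ, ψ, hα, hφ₀, hφ, hψ, hn, ht⟩ := exists_tail_eq (exists_rowVec_eq d) w hw
  obtain ⟨ψ₀, hψ₀, hz⟩ := exists_sinCoef_eq (w 0) φ₀ hn
  refine ⟨α, Fin.cons φ₀ φ, Fin.cons ψ₀ ψ, hα, Fin.cases hφ₀ hφ, Fin.cases hψ₀ hψ, ?_⟩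
  rw [prodH_last_eq_cons]
  ext i
  refine Fin.cases ?_ (fun i => ?_) i
  · simp only [sinCoef, Fin.cons_zero]
    rw [← hz]
  · simp only [Fin.cons_succ, Fin.cons_zero]
    exact (congrFun ht i).symm

lemma sum_norm_sq_row {n : ℕ} {W : Matrix (Fin n) (Fin n) ℂ} (hW : W ∈ unitaryGroup (Fin n) ℂ)
    (i : Fin n) : ∑ j, ‖W i j‖ ^ 2 = 1 := by
  have := congrFun (congrFun (mem_unitaryGroup_iff.1 hW) i) i
  rw [Matrix.mul_apply, one_apply_eq] at this
  simp only [star_apply, Complex.star_def, Complex.mul_conj, Complex.normSq_eq_norm_sq] at this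
  exact_mod_cast this

/-- If two unitary matrices have the same last row, they differ by a block diagonal one. -/
lemma exists_eq_diagOne_mul {m : ℕ} {W H : Matrix (Fin (m + 1)) (Fin (m + 1)) ℂ}
    (hW : W ∈ unitaryGroup (Fin (m + 1)) ℂ) (hH : H ∈ unitaryGroup (Fin (m + 1)) ℂ)
    (h : H (Fin.last m) = W (Fin.last m)) :
    ∃ A ∈ unitaryGroup (Fin m) ℂ, W = diagOne A * H := by
  have hrow : (W * star H) (Fin.last m) = Pi.single (Fin.last m) 1 := by
    have h1 : (W * star H) (Fin.last m) = (H * star H) (Fin.last m) := by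
      ext s
      rw [Matrix.mul_apply, Matrix.mul_apply, h]
    rw [h1, mem_unitaryGroup_iff.1 hH]
    ext s
    simp [Matrix.one_apply, Pi.single_apply, eq_comm]
  obtain ⟨A, hA, hWA⟩ := exists_eq_diagOne (mul_mem hW (Unitary.star_mem hH)) hrow
  refine ⟨A, hA, ?_⟩
  rw [← hWA, mul_assoc, mem_unitaryGroup_iff'.1 hH, mul_one]

theorem exists_V_eq (n : ℕ) (W : Matrix (Fin (n + 1)) (Fin (n + 1)) ℂ)
    (hW : W ∈ unitaryGroup (Fin (n + 1)) ℂ) :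
    ∃ (α : Fin (n + 1) → ℝ) (φ ψ : PairAngles (n + 1)), InRange α φ ψ ∧ V (n + 1) α φ ψ = W := by
  induction n with
  | zero =>
    obtain ⟨α, hα, h⟩ := exists_angle (star (W 0 0))
    have hz : ∀ (k : Fin 1), Fin k.val → False := fun k j => by
      have := j.isLt
      omega
    refine ⟨fun _ => α, fun k j => (hz k j).elim, fun k j => (hz k j).elim,
      ⟨fun _ => hα, fun k j => (hz k j).elim, fun k j => (hz k j).elim⟩, ?_⟩
    have h1 : ‖W 0 0‖ = 1 := by
      have := sum_norm_sq_row hW 0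
      rw [Fin.sum_univ_one] at this
      nlinarith [norm_nonneg (W 0 0)]
    rw [norm_star, h1, Complex.ofReal_one, one_mul, exp_neg_I_mul, star_inj] at h
    ext i j
    obtain rfl : i = 0 := Subsingleton.elim (α := Fin 1) _ _
    obtain rfl : j = 0 := Subsingleton.elim (α := Fin 1) _ _
    rw [h, V]
    rfl
  | succ n ih =>
    obtain ⟨α₁, φ₁, ψ₁, hα₁, hφ₁, hψ₁, h⟩ :=
      exists_prodH_last_eq (W (Fin.last (n + 1))) (sum_norm_sq_row hW _)
    obtain ⟨A, hA, hWA⟩ := exists_eq_diagOne_mul hW (prodH_mem_unitaryGroup α₁ φ₁ ψ₁) h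
    obtain ⟨α, φ, ψ, hr, hV⟩ := ih A hA
    refine ⟨Fin.snoc α α₁, Fin.snoc (α := fun k : Fin (n + 2) => Fin k → ℝ) φ φ₁,
      Fin.snoc (α := fun k : Fin (n + 2) => Fin k → ℝ) ψ ψ₁, ⟨?_, ?_, ?_⟩, ?_⟩
    · refine Fin.lastCases ?_ fun k => ?_
      · rw [Fin.snoc_last]; exact hα₁
      · rw [Fin.snoc_castSucc]; exact hr.alpha k
    · refine Fin.lastCases ?_ fun k => ?_
      · rw [Fin.snoc_last]; exact hφ₁
      · rw [Fin.snoc_castSucc]; exact hr.phi k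
    · refine Fin.lastCases ?_ fun k => ?_
      · rw [Fin.snoc_last]; exact hψ₁
      · rw [Fin.snoc_castSucc]; exact hr.psi k
    · rw [V]
      simp only [Fin.snoc_last, Fin.snoc_castSucc]
      rw [hV, hWA]

/-! ### Uniqueness of the angles. -/

/-- The first entry gives t 0, hence k 0 by `hkt`; dividing by this nonzero factor leaves a shorter
vector. In the application `hkt` says that the sine entry determines φ and therefore the cosine. -/
lemma rowVec_injective (d : ℕ) {k k' t t' : Fin d → ℂ} (hk : ∀ j, k j ≠ 0)
    (hkt : ∀ j, t j = t' j → k j = k' j) (h : rowVec d k t = rowVec d k' t') : t = t' := by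
  induction d with
  | zero => exact Subsingleton.elim _ _
  | succ d ih =>
    have h0 : t 0 = t' 0 := by simpa [rowVec] using congrFun h 0
    have hk0 := hkt 0 h0
    have htail := ih (fun j => hk j.succ) (fun j => hkt j.succ) (by
      ext i
      have := congrFun h i.succ
      simp only [rowVec, Fin.cons_succ, Pi.smul_apply, smul_eq_mul, ← hk0] at this
      exact mul_left_cancel₀ (hk 0) this)
    ext j
    exact Fin.cases h0 (congrFun htail) j

lemma angles_eq_of_sinCoef_eq {x x' y y' : ℝ} (hx : x ∈ Set.Ioo 0 (Real.pi / 2))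
    (hx' : x' ∈ Set.Ioo 0 (Real.pi / 2)) (hy : y ∈ Set.Ico (-Real.pi) Real.pi)
    (hy' : y' ∈ Set.Ico (-Real.pi) Real.pi)
    (h : -(Complex.exp (-(Complex.I * (y : ℂ))) * (Real.sin x : ℂ)) =
      -(Complex.exp (-(Complex.I * (y' : ℂ))) * (Real.sin x' : ℂ))) : x = x' ∧ y = y' := by
  have hpos {x : ℝ} (hx : x ∈ Set.Ioo 0 (Real.pi / 2)) : 0 < Real.sin x :=
    Real.sin_pos_of_pos_of_lt_pi hx.1 (by linarith [hx.2, Real.pi_pos])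
  have hsin : Real.sin x = Real.sin x' := by
    have := congrArg norm h
    rwa [norm_neg, norm_neg, norm_mul, norm_mul, norm_exp_neg_I_mul, norm_exp_neg_I_mul, one_mul, one_mul, Complex.norm_real,
      Complex.norm_real, Real.norm_of_nonneg (hpos hx).le, Real.norm_of_nonneg (hpos hx').le]
      at this
  have hxx : x = x' := Real.injOn_sin ⟨by linarith [hx.1, Real.pi_pos], hx.2.le⟩
    ⟨by linarith [hx'.1, Real.pi_pos], hx'.2.le⟩ hsin
  refine ⟨hxx, angle_eq_of_exp_eq hy hy' ?_⟩
  rw [← hxx, neg_inj] at h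
  have hne : (Real.sin x : ℂ) ≠ 0 := by exact_mod_cast (hpos hx).ne'
  exact mul_right_cancel₀ hne h

/-- The last entry of the row is e^{-iα} times a positive number, so its phase determines α. With α
known, the other angles are read off from left to right. -/
lemma prodH_injective {d : ℕ} {α α' : ℝ} {φ ψ φ' ψ' : Fin (d + 1) → ℝ}
    (hα : α ∈ Set.Ico (-Real.pi) Real.pi) (hα' : α' ∈ Set.Ico (-Real.pi) Real.pi)
    (hψ : ∀ j, ψ j ∈ Set.Ico (-Real.pi) Real.pi) (hψ' : ∀ j, ψ' j ∈ Set.Ico (-Real.pi) Real.pi)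
    (hφ : ∀ j, φ j ∈ Set.Ioo 0 (Real.pi / 2)) (hφ' : ∀ j, φ' j ∈ Set.Ioo 0 (Real.pi / 2))
    (h : prodH α φ ψ (Fin.last (d + 1)) = prodH α' φ' ψ' (Fin.last (d + 1))) :
    α = α' ∧ φ = φ' ∧ ψ = ψ' := by
  have hcos {φ : Fin (d + 1) → ℝ} (hφ : ∀ j, φ j ∈ Set.Ioo 0 (Real.pi / 2)) (j) :
      0 < Real.cos (φ j) :=
    Real.cos_pos_of_mem_Ioo ⟨by linarith [(hφ j).1, Real.pi_pos], (hφ j).2⟩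
  rw [prodH_last, prodH_last] at h
  have hprod (α : ℝ) (φ : Fin (d + 1) → ℝ) : ∏ i, cosCoef α φ i =
      Complex.exp (-(Complex.I * (α : ℂ))) * ((∏ i, Real.cos (φ i) : ℝ) : ℂ) := by
    rw [Fin.prod_univ_succ, cosCoef_zero, Fin.prod_univ_succ]
    have (i : Fin d) : cosCoef α φ i.succ = (Real.cos (φ i.succ) : ℂ) :=
      congrFun (cosCoef_succ α φ) i
    simp only [this]
    push_cast
    ring
  have hαα : α = α' := by
    have hl := congrFun h (Fin.last _)
    rw [rowVec_last, rowVec_last, hprod, hprod] at hl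
    refine angle_eq_of_exp_eq hα hα' ?_
    have p1 : 0 < ∏ i, Real.cos (φ i) := Finset.prod_pos fun i _ => hcos hφ i
    have p2 : 0 < ∏ i, Real.cos (φ' i) := Finset.prod_pos fun i _ => hcos hφ' i
    have hn := congrArg norm hl
    rw [norm_mul, norm_mul, norm_exp_neg_I_mul, norm_exp_neg_I_mul, one_mul, one_mul, Complex.norm_real, Complex.norm_real,
      Real.norm_of_nonneg p1.le, Real.norm_of_nonneg p2.le] at hn
    rw [← hn] at hl
    have hne : ((∏ i, Real.cos (φ i) : ℝ) : ℂ) ≠ 0 := by exact_mod_cast p1.ne'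
    exact mul_right_cancel₀ hne hl
  subst hαα
  have ht := rowVec_injective (d + 1) (k := cosCoef α φ) (k' := cosCoef α φ')
    (fun j => mul_ne_zero (Complex.exp_ne_zero _) (by exact_mod_cast (hcos hφ j).ne'))
    (fun j hj => by
      have := (angles_eq_of_sinCoef_eq (hφ j) (hφ' j) (hψ j) (hψ' j) hj).1
      rw [cosCoef, cosCoef, this]) h
  have hj (j) := angles_eq_of_sinCoef_eq (hφ j) (hφ' j) (hψ j) (hψ' j) (congrFun ht j)
  exact ⟨rfl, funext fun j => (hj j).1, funext fun j => (hj j).2⟩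

theorem V_injective (n : ℕ) (α α' : Fin (n + 1) → ℝ) (φ ψ φ' ψ' : PairAngles (n + 1))
    (hr : InRange α φ ψ) (hr' : InRange α' φ' ψ')
    (hφ : ∀ k j, φ k j ∈ Set.Ioo 0 (Real.pi / 2)) (hφ' : ∀ k j, φ' k j ∈ Set.Ioo 0 (Real.pi / 2))
    (h : V (n + 1) α φ ψ = V (n + 1) α' φ' ψ') : α = α' ∧ φ = φ' ∧ ψ = ψ' := by
  induction n with
  | zero =>
    have hz : ∀ (k : Fin 1), Fin k.val → False := fun k j => by
      have := j.isLt
      omega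
    refine ⟨?_, funext fun k => funext fun j => (hz k j).elim,
      funext fun k => funext fun j => (hz k j).elim⟩
    have h00 := congrFun (congrFun h 0) 0
    simp only [V, Matrix.of_apply] at h00
    ext k
    obtain rfl : k = 0 := Subsingleton.elim (α := Fin 1) _ _
    refine angle_eq_of_exp_eq (hr.alpha 0) (hr'.alpha 0) ?_
    rw [Complex.exp_neg, Complex.exp_neg, h00]
  | succ n ih =>
    rw [V, V] at h
    have hlast := congrFun h (Fin.last (n + 1))
    rw [diagOne_mul_last, diagOne_mul_last] at hlast
    obtain ⟨e1, e2, e3⟩ := prodH_injective (hr.alpha _) (hr'.alpha _) (hr.psi (Fin.last _))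
      (hr'.psi (Fin.last _)) (hφ (Fin.last _)) (hφ' (Fin.last _)) hlast
    rw [e1, e2, e3] at h
    have hH := mem_unitaryGroup_iff.1 (prodH_mem_unitaryGroup (m := n + 1) (α' (Fin.last (n + 1)))
      (φ' (Fin.last (n + 1))) (ψ' (Fin.last (n + 1))))
    have h' := congrArg (· * star (prodH (m := n + 1) (α' (Fin.last (n + 1)))
      (φ' (Fin.last (n + 1))) (ψ' (Fin.last (n + 1))))) h
    simp only [mul_assoc, hH, mul_one] at h'
    obtain ⟨i1, i2, i3⟩ := ih _ _ _ _ _ _ ⟨fun k => hr.alpha _, fun k => hr.phi k.castSucc,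
      fun k => hr.psi k.castSucc⟩ ⟨fun k => hr'.alpha _, fun k => hr'.phi k.castSucc,
        fun k => hr'.psi k.castSucc⟩
      (fun k => hφ k.castSucc) (fun k => hφ' k.castSucc) (diagOne_injective h')
    refine ⟨?_, ?_, ?_⟩
    · exact funext fun k => Fin.lastCases e1 (congrFun i1) k
    · exact funext fun k => Fin.lastCases e2 (congrFun i2) k
    · exact funext fun k => Fin.lastCases e3 (congrFun i3) k

/-! ### The coordinate measures, polar integration and the uniform measure on the sphere. -/

instance isProbabilityMeasure_angleMeasure : IsProbabilityMeasure angleMeasure := by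
  constructor
  rw [angleMeasure, Measure.smul_apply, Measure.restrict_apply_univ, Real.volume_Ico, smul_eq_mul,
    ← ENNReal.ofReal_mul (by positivity)]
  have := Real.pi_pos
  rw [show 1 / (2 * Real.pi) * (Real.pi - -Real.pi) = 1 by field_simp; ring, ENNReal.ofReal_one]

lemma phiMeasure_univ (d : ℕ) : phiMeasure (d + 1) Set.univ = 1 := by
  have hI : ∫ φ in (0 : ℝ)..(Real.pi / 2),
      2 * ((d + 1 : ℕ) : ℝ) * Real.cos φ ^ (2 * (d + 1) - 1) * Real.sin φ = 1 := by
    have hderiv : ∀ φ ∈ Set.uIcc (0 : ℝ) (Real.pi / 2),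
        HasDerivAt (fun φ => -(Real.cos φ ^ (2 * (d + 1))))
          (2 * ((d + 1 : ℕ) : ℝ) * Real.cos φ ^ (2 * (d + 1) - 1) * Real.sin φ) φ := by
      intro φ _
      have := ((Real.hasDerivAt_cos φ).pow (2 * (d + 1))).neg
      convert! this using 1
      push_cast
      ring
    rw [intervalIntegral.integral_eq_sub_of_hasDerivAt hderiv
      (Continuous.intervalIntegrable (by fun_prop) _ _)]
    simp
  have hle : (0 : ℝ) ≤ Real.pi / 2 := by positivity
  rw [phiMeasure, withDensity_apply _ MeasurableSet.univ, Measure.restrict_univ,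
    ← ofReal_integral_eq_lintegral_ofReal]
  · rw [integral_Icc_eq_integral_Ioc, ← intervalIntegral.integral_of_le hle, hI,
      ENNReal.ofReal_one]
  · exact (Continuous.integrableOn_Icc (by fun_prop))
  · refine (ae_restrict_iff' measurableSet_Icc).2 (Filter.Eventually.of_forall fun φ hφ => ?_)
    have h1 : 0 ≤ Real.cos φ := Real.cos_nonneg_of_mem_Icc ⟨by linarith [hφ.1, Real.pi_pos], hφ.2⟩
    have h2 : 0 ≤ Real.sin φ :=
      Real.sin_nonneg_of_nonneg_of_le_pi hφ.1 (by linarith [hφ.2, Real.pi_pos])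
    simp only [Pi.zero_apply]
    positivity

instance isProbabilityMeasure_phiMeasure (d : ℕ) : IsProbabilityMeasure (phiMeasure (d + 1)) :=
  ⟨phiMeasure_univ d⟩

/-- For d = 0 the density is zero. That case never occurs in `coordMeasure`, but an instance for
every d lets σ-finiteness be found for exponents such as `k.val - j.val`. -/
instance isFiniteMeasure_phiMeasure (d : ℕ) : IsFiniteMeasure (phiMeasure d) := by
  cases d with
  | zero =>
    constructor
    simp [phiMeasure]
  | succ d => infer_instance

lemma measurable_finCons {X : Type*} [MeasurableSpace X] {d : ℕ} {E : Type*} [MeasurableSpace E]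
    {f : X → E} {g : X → Fin d → E} (hf : Measurable f) (hg : Measurable g) :
    Measurable fun x => (Fin.cons (f x) (g x) : Fin (d + 1) → E) := by
  refine measurable_pi_iff.2 fun i => ?_
  refine Fin.cases ?_ (fun i => ?_) i
  · simpa using hf
  · simpa using measurable_pi_iff.1 hg i

lemma lintegral_pi_succ {X : Type*} [MeasurableSpace X] {d : ℕ} (μ : Fin (d + 1) → Measure X)
    [∀ i, SigmaFinite (μ i)] {f : (Fin (d + 1) → X) → ℝ≥0∞} (hf : Measurable f) :
    ∫⁻ x, f x ∂Measure.pi μ =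
      ∫⁻ a, ∫⁻ b, f (Fin.cons a b) ∂Measure.pi (fun i => μ i.succ) ∂μ 0 := by
  have h := (measurePreserving_piFinSuccAbove μ 0).symm
  have hm := (hf.comp
    (MeasurableEquiv.piFinSuccAbove (fun _ => X) 0).symm.measurable).aemeasurable
    (μ := (μ 0).prod (Measure.pi fun i => μ (Fin.succAbove 0 i)))
  rw [← h.lintegral_comp hf]
  refine (lintegral_prod _ hm).trans ?_
  simp only [Fin.succAbove_zero]
  refine lintegral_congr fun a => lintegral_congr fun b => ?_
  exact congrArg f (Fin.insertNth_zero' a b)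

/-- The uniform probability measure on the unit circle, as a measure on `ℂ`. -/
def circleMeasure : Measure ℂ :=
  angleMeasure.map fun θ : ℝ => Complex.exp (Complex.I * (θ : ℂ))

lemma measurable_exp_I : Measurable fun θ : ℝ => Complex.exp (Complex.I * (θ : ℂ)) := by
  fun_prop

instance isProbabilityMeasure_circleMeasure : IsProbabilityMeasure circleMeasure :=
  Measure.isProbabilityMeasure_map measurable_exp_I.aemeasurable

lemma norm_eq_one_ae_circleMeasure : ∀ᵐ u ∂circleMeasure, ‖u‖ = 1 := by
  rw [circleMeasure, ae_map_iff measurable_exp_I.aemeasurable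
    (measurableSet_eq_fun measurable_norm measurable_const)]
  refine Filter.Eventually.of_forall fun θ => ?_
  rw [mul_comm, Complex.norm_exp_ofReal_mul_I]

lemma lintegral_polar_circleMeasure {f : ℂ → ℝ≥0∞} (hf : Measurable f) :
    ∫⁻ r in Set.Ioi (0 : ℝ), ENNReal.ofReal r * ∫⁻ u, f (r • u) ∂circleMeasure =
      ENNReal.ofReal (1 / (2 * Real.pi)) * ∫⁻ z, f z := by
  rw [← Complex.lintegral_comp_polarCoord_symm, polarCoord_target, Measure.volume_eq_prod,
    ← Measure.prod_restrict, lintegral_prod]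
  · rw [← lintegral_const_mul]
    · refine lintegral_congr fun r => ?_
      rw [circleMeasure, lintegral_map (by fun_prop) measurable_exp_I, angleMeasure,
        lintegral_smul_measure, Measure.restrict_congr_set Ioo_ae_eq_Ico.symm, smul_eq_mul,
        mul_left_comm, ← lintegral_const_mul _ (by fun_prop)]
      congr 1
      refine lintegral_congr fun θ => ?_
      rw [smul_eq_mul, Complex.polarCoord_symm_apply, mul_comm Complex.I, Complex.exp_mul_I,
        Complex.real_smul, Complex.ofReal_cos, Complex.ofReal_sin]
    · simp only [Complex.polarCoord_symm_apply]
      fun_prop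
  · simp only [Complex.polarCoord_symm_apply]
    fun_prop

/-- The uniform probability measure on the unit sphere of `ℂ^{d+1}`. -/
def sphereMeasure : (d : ℕ) → Measure (Fin (d + 1) → ℂ)
  | 0 => circleMeasure.map fun u _ => u
  | d + 1 => (circleMeasure.prod ((phiMeasure (d + 1)).prod (sphereMeasure d))).map fun p =>
      Fin.cons (p.1 * (Real.sin p.2.1 : ℂ)) ((Real.cos p.2.1 : ℂ) • p.2.2)

lemma measurable_sphereMap (d : ℕ) :
    Measurable fun p : ℂ × ℝ × (Fin (d + 1) → ℂ) =>
      (Fin.cons (p.1 * (Real.sin p.2.1 : ℂ)) ((Real.cos p.2.1 : ℂ) • p.2.2) :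
        Fin (d + 2) → ℂ) := by
  apply measurable_finCons <;> fun_prop

instance isProbabilityMeasure_sphereMeasure (d : ℕ) : IsProbabilityMeasure (sphereMeasure d) := by
  induction d with
  | zero => exact Measure.isProbabilityMeasure_map (by fun_prop)
  | succ d ih => exact Measure.isProbabilityMeasure_map (measurable_sphereMap d).aemeasurable

lemma lintegral_sphereMeasure_succ (d : ℕ) {f : (Fin (d + 2) → ℂ) → ℝ≥0∞} (hf : Measurable f) :
    ∫⁻ x, f x ∂sphereMeasure (d + 1) = ∫⁻ u, ∫⁻ φ, ∫⁻ x,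
      f (Fin.cons (u * (Real.sin φ : ℂ)) ((Real.cos φ : ℂ) • x))
        ∂sphereMeasure d ∂phiMeasure (d + 1) ∂circleMeasure := by
  have hm := hf.comp (measurable_sphereMap d)
  rw [sphereMeasure, lintegral_map hf (measurable_sphereMap d)]
  refine (lintegral_prod _ hm.aemeasurable).trans (lintegral_congr fun u => ?_)
  exact lintegral_prod _ (hm.comp measurable_prodMk_left).aemeasurable

/-- Planar polar coordinates restricted to the open first quadrant. The angle is measured from the
second axis, so that the sine belongs to the first radius as in H; this is the reason for
`Prod.swap` in the proof. -/
lemma lintegral_quadrant_polar {g : ℝ × ℝ → ℝ≥0∞} (hg : Measurable g) :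
    ∫⁻ a in Set.Ioi (0 : ℝ), ∫⁻ b in Set.Ioi (0 : ℝ), g (a, b) =
      ∫⁻ r in Set.Ioi (0 : ℝ), ∫⁻ φ in Set.Icc 0 (Real.pi / 2),
        ENNReal.ofReal r * g (r * Real.sin φ, r * Real.cos φ) := by
  have hQ : MeasurableSet (Set.Ioi (0 : ℝ) ×ˢ Set.Ioi (0 : ℝ)) :=
    measurableSet_Ioi.prod measurableSet_Ioi
  have hmF : Measurable ((Set.Ioi (0 : ℝ) ×ˢ Set.Ioi (0 : ℝ)).indicator fun p => g p.swap) :=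
    (hg.comp measurable_swap).indicator hQ
  have h := lintegral_comp_polarCoord_symm
    ((Set.Ioi (0 : ℝ) ×ˢ Set.Ioi (0 : ℝ)).indicator fun p => g p.swap)
  have hR : ∫⁻ p, (Set.Ioi (0 : ℝ) ×ˢ Set.Ioi (0 : ℝ)).indicator (fun p => g p.swap) p =
      ∫⁻ a in Set.Ioi (0 : ℝ), ∫⁻ b in Set.Ioi (0 : ℝ), g (a, b) := by
    rw [lintegral_indicator hQ, Measure.volume_eq_prod, ← Measure.prod_restrict]
    exact lintegral_prod_symm _ (hg.comp measurable_swap).aemeasurable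
  rw [← hR, ← h, polarCoord_target, Measure.volume_eq_prod, ← Measure.prod_restrict,
    lintegral_prod]
  · refine setLIntegral_congr_fun measurableSet_Ioi fun r hr => ?_
    have hr' : 0 < r := hr
    have hind (φ : ℝ) (hφ : φ ∈ Set.Ioo (-Real.pi) Real.pi) :
        ENNReal.ofReal r • (Set.Ioi (0 : ℝ) ×ˢ Set.Ioi (0 : ℝ)).indicator (fun p => g p.swap)
          (polarCoord.symm (r, φ)) = (Set.Ioo 0 (Real.pi / 2)).indicator
            (fun φ => ENNReal.ofReal r * g (r * Real.sin φ, r * Real.cos φ)) φ := by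
      have hiff : polarCoord.symm (r, φ) ∈ Set.Ioi (0 : ℝ) ×ˢ Set.Ioi (0 : ℝ) ↔
          φ ∈ Set.Ioo 0 (Real.pi / 2) := by
        rw [polarCoord_symm_apply, Set.mem_prod, Set.mem_Ioi, Set.mem_Ioi]
        simp only [mul_pos_iff_of_pos_left hr']
        constructor
        · rintro ⟨hc, hs⟩
          constructor
          · by_contra! h0
            exact absurd (Real.sin_nonpos_of_nonpos_of_neg_pi_le h0 hφ.1.le) (not_le.2 hs)
          · by_contra! h0
            exact absurd (Real.cos_nonpos_of_pi_div_two_le_of_le h0 (by linarith [hφ.2]))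
              (not_le.2 hc)
        · rintro ⟨h0, h1⟩
          exact ⟨Real.cos_pos_of_mem_Ioo ⟨by linarith, h1⟩,
            Real.sin_pos_of_pos_of_lt_pi h0 hφ.2⟩
      by_cases hmem : φ ∈ Set.Ioo 0 (Real.pi / 2)
      · rw [Set.indicator_of_mem hmem, Set.indicator_of_mem (hiff.2 hmem)]
        rfl
      · rw [Set.indicator_of_notMem hmem, Set.indicator_of_notMem (fun h => hmem (hiff.1 h)),
          smul_zero]
    rw [setLIntegral_congr_fun measurableSet_Ioo hind, lintegral_indicator measurableSet_Ioo,
      Measure.restrict_restrict measurableSet_Ioo, Set.inter_eq_left.2,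
      Measure.restrict_congr_set Ioo_ae_eq_Icc]
    intro φ hφ
    exact ⟨by linarith [hφ.1, Real.pi_pos], by linarith [hφ.2, Real.pi_pos]⟩
  · refine Measurable.aemeasurable ?_
    have : Measurable (polarCoord.symm : ℝ × ℝ → ℝ × ℝ) := continuous_polarCoord_symm.measurable
    have := hmF.comp this
    fun_prop

lemma volume_pi_complex (d : ℕ) :
    (volume : Measure (Fin d → ℂ)) = Measure.pi fun _ => volume := rfl

/-- Polar integration for `circleMeasure` and `sphereMeasure`, up to the normalising constant. -/
lemma exists_lintegral_polar_sphereMeasure (d : ℕ) : ∃ C : ℝ≥0∞,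
    ∀ f : (Fin (d + 1) → ℂ) → ℝ≥0∞, Measurable f →
      ∫⁻ r in Set.Ioi (0 : ℝ), ENNReal.ofReal (r ^ (2 * d + 1)) *
        ∫⁻ x, f (r • x) ∂sphereMeasure d = C * ∫⁻ z, f z := by
  induction d with
  | zero =>
    refine ⟨ENNReal.ofReal (1 / (2 * Real.pi)), fun f hf => ?_⟩
    have h := lintegral_polar_circleMeasure (f := fun z => f fun _ => z) (by fun_prop)
    have hvol : ∫⁻ z, f z = ∫⁻ z : ℂ, f fun _ => z := by
      exact ((volume_preserving_funUnique (Fin 1) ℂ).symm.lintegral_comp hf).symm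
    rw [hvol, ← h]
    refine lintegral_congr fun r => ?_
    rw [sphereMeasure, lintegral_map (by fun_prop) (by fun_prop),
      show r ^ (2 * 0 + 1) = r by simp]
    rfl
  | succ d ih =>
    obtain ⟨C, hC⟩ := ih
    -- This is the normalising factor of the density of `phiMeasure (d + 1)`.
    set c := ENNReal.ofReal (2 * ((d + 1 : ℕ) : ℝ)) with hc
    refine ⟨c * C * ENNReal.ofReal (1 / (2 * Real.pi)), fun f hf => ?_⟩
    have hcons : Measurable fun p : ℂ × (Fin (d + 1) → ℂ) =>
        f (Fin.cons p.1 p.2 : Fin (d + 2) → ℂ) :=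
      hf.comp (measurable_finCons measurable_fst measurable_snd)
    -- Polar integration in the first coordinate, with radius a, and in the tail, with radius b,
    -- leaves the integral of g over the quadrant. Polar coordinates a = r sin φ, b = r cos φ then
    -- produce the total radius and the angle φ.
    let g : ℝ × ℝ → ℝ≥0∞ := fun p => ENNReal.ofReal p.1 * (ENNReal.ofReal (p.2 ^ (2 * d + 1)) *
      ∫⁻ u, ∫⁻ x, f (Fin.cons (p.1 • u) (p.2 • x) : Fin (d + 2) → ℂ)
        ∂sphereMeasure d ∂circleMeasure)
    have hg : Measurable g := by
      have h1 : Measurable fun p : (ℝ × ℝ) × ℂ => ∫⁻ x,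
          f (Fin.cons (p.1.1 • p.2) (p.1.2 • x) : Fin (d + 2) → ℂ) ∂sphereMeasure d := by
        refine Measurable.lintegral_prod_right' (f := fun q : ((ℝ × ℝ) × ℂ) × (Fin (d + 1) → ℂ) =>
          f (Fin.cons (q.1.1.1 • q.1.2) (q.1.1.2 • q.2) : Fin (d + 2) → ℂ)) ?_
        exact hf.comp (measurable_finCons (by fun_prop) (by fun_prop))
      have h2 := h1.lintegral_prod_right' (ν := circleMeasure)
      fun_prop
    have hrhs : ∫⁻ a in Set.Ioi (0 : ℝ), ∫⁻ b in Set.Ioi (0 : ℝ), g (a, b) =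
        C * (ENNReal.ofReal (1 / (2 * Real.pi)) * ∫⁻ z, f z) := by
      have hvol : ∫⁻ z, f z = ∫⁻ z : ℂ, ∫⁻ z', f (Fin.cons z z' : Fin (d + 2) → ℂ) := by
        rw [volume_pi_complex, lintegral_pi_succ _ hf]
        rfl
      rw [hvol, ← lintegral_polar_circleMeasure (Measurable.lintegral_prod_right' hcons),
        ← lintegral_const_mul]
      · refine lintegral_congr fun a => ?_
        have hinner : ∀ u : ℂ, C * ∫⁻ z', f (Fin.cons (a • u) z' : Fin (d + 2) → ℂ) =
            ∫⁻ b in Set.Ioi (0 : ℝ), ENNReal.ofReal (b ^ (2 * d + 1)) *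
              ∫⁻ x, f (Fin.cons (a • u) (b • x) : Fin (d + 2) → ℂ) ∂sphereMeasure d := fun u =>
          (hC (fun z' => f (Fin.cons (a • u) z' : Fin (d + 2) → ℂ))
            (hcons.comp measurable_prodMk_left)).symm
        have hm : Measurable fun u : ℂ => ∫⁻ z', f (Fin.cons (a • u) z' : Fin (d + 2) → ℂ) := by
          refine Measurable.lintegral_prod_right' (f := fun q : ℂ × (Fin (d + 1) → ℂ) =>
            f (Fin.cons (a • q.1) q.2 : Fin (d + 2) → ℂ)) ?_
          exact hf.comp (measurable_finCons (by fun_prop) (by fun_prop))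
        rw [mul_left_comm, ← lintegral_const_mul _ hm]
        simp only [hinner, g]
        have hm3 : Measurable fun q : (ℝ × ℂ) × (Fin (d + 1) → ℂ) =>
            f (Fin.cons (a • q.1.2) (q.1.1 • q.2) : Fin (d + 2) → ℂ) :=
          hf.comp (measurable_finCons (by fun_prop) (by fun_prop))
        have hm2 := hm3.lintegral_prod_right' (ν := sphereMeasure d)
        have hm1 := hm2.lintegral_prod_right' (ν := circleMeasure)
        rw [lintegral_const_mul _ (by fun_prop)]
        congr 1
        have (b : ℝ) : ENNReal.ofReal (b ^ (2 * d + 1)) *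
            ∫⁻ u, ∫⁻ x, f (Fin.cons (a • u) (b • x) : Fin (d + 2) → ℂ)
              ∂sphereMeasure d ∂circleMeasure = ∫⁻ u, ENNReal.ofReal (b ^ (2 * d + 1)) *
              ∫⁻ x, f (Fin.cons (a • u) (b • x) : Fin (d + 2) → ℂ)
              ∂sphereMeasure d ∂circleMeasure :=
          (lintegral_const_mul _ (hm2.comp measurable_prodMk_left)).symm
        simp only [this]
        refine lintegral_lintegral_swap (Measurable.aemeasurable ?_)
        exact Measurable.mul (by fun_prop) hm2
      · have hm1 : Measurable fun q : (ℝ × ℂ) × (Fin (d + 1) → ℂ) =>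
            f (Fin.cons (q.1.1 • q.1.2) q.2 : Fin (d + 2) → ℂ) :=
          hf.comp (measurable_finCons (by fun_prop) (by fun_prop))
        have hm2 := (hm1.lintegral_prod_right' (ν := volume)).lintegral_prod_right'
          (ν := circleMeasure)
        fun_prop
    rw [mul_assoc, mul_assoc, ← hrhs, lintegral_quadrant_polar hg, ← lintegral_const_mul]
    · refine setLIntegral_congr_fun measurableSet_Ioi fun r hr => ?_
      have hr' : 0 < r := hr
      have hsm : Measurable fun x : Fin (d + 2) → ℂ => f (r • x) := by fun_prop
      rw [lintegral_sphereMeasure_succ d hsm]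
      have hm3 : Measurable fun q : (ℂ × ℝ) × (Fin (d + 1) → ℂ) =>
          f (r • (Fin.cons (q.1.1 * (Real.sin q.1.2 : ℂ)) ((Real.cos q.1.2 : ℂ) • q.2) :
            Fin (d + 2) → ℂ)) :=
        hsm.comp (measurable_finCons (by fun_prop) (by fun_prop))
      have hm2 := hm3.lintegral_prod_right' (ν := sphereMeasure d)
      rw [lintegral_lintegral_swap hm2.aemeasurable, phiMeasure,
        lintegral_withDensity_eq_lintegral_mul _ (by fun_prop)
          (hm2.lintegral_prod_left' (μ := circleMeasure)),
        ← lintegral_const_mul, ← lintegral_const_mul]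
      · refine setLIntegral_congr_fun measurableSet_Icc fun φ hφ => ?_
        have h1 : 0 ≤ Real.cos φ :=
          Real.cos_nonneg_of_mem_Icc ⟨by linarith [hφ.1, Real.pi_pos], hφ.2⟩
        have h2 : 0 ≤ Real.sin φ :=
          Real.sin_nonneg_of_nonneg_of_le_pi hφ.1 (by linarith [hφ.2, Real.pi_pos])
        have hcons_eq (u : ℂ) (x : Fin (d + 1) → ℂ) :
            r • (Fin.cons (u * (Real.sin φ : ℂ)) ((Real.cos φ : ℂ) • x) : Fin (d + 2) → ℂ) =
              Fin.cons ((r * Real.sin φ) • u) ((r * Real.cos φ) • x) := by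
          ext i
          refine Fin.cases ?_ (fun i => ?_) i
          · simp only [Pi.smul_apply, Fin.cons_zero, Complex.real_smul]
            push_cast
            ring
          · simp only [Pi.smul_apply, Fin.cons_succ, Complex.real_smul, smul_eq_mul]
            push_cast
            ring
        simp only [Pi.mul_apply, hcons_eq, g, ← mul_assoc]
        congr 1
        rw [hc, ← ENNReal.ofReal_mul (by positivity), ← ENNReal.ofReal_mul (by positivity),
          ← ENNReal.ofReal_mul (by positivity), ← ENNReal.ofReal_mul (by positivity)]
        congr 1
        -- The Jacobians agree: r (r sin φ) (r cos φ)^(2d+1) = r^(2d+3) (cos φ)^(2d+1) sin φ. This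
        -- fixes the exponent in the density of φ.
        rw [show 2 * (d + 1) - 1 = 2 * d + 1 by omega]
        ring
      · have := hg
        fun_prop
      · have := hm2.lintegral_prod_left' (μ := circleMeasure)
        exact Measurable.mul (by fun_prop) this
    · have hm : Measurable fun q : ℝ × ℝ =>
          ENNReal.ofReal q.1 * g (q.1 * Real.sin q.2, q.1 * Real.cos q.2) := by
        fun_prop
      exact hm.lintegral_prod_right'

/-- A measure on the unit sphere of a positively homogeneous function `N` which is the angular
part of `ν` inherits the symmetries of `ν` that preserve `N`. -/
lemma map_eq_self_of_polar {E : Type*} [NormedAddCommGroup E] [NormedSpace ℝ E]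
    [MeasurableSpace E] [BorelSpace E] [SecondCountableTopology E]
    {S ν : Measure E} [IsFiniteMeasure S] {k : ℕ} {C : ℝ≥0∞}
    (hpolar : ∀ f : E → ℝ≥0∞, Measurable f →
      ∫⁻ r in Set.Ioi (0 : ℝ), ENNReal.ofReal (r ^ k) * ∫⁻ x, f (r • x) ∂S = C * ∫⁻ z, f z ∂ν)
    {N : E → ℝ} (hN : Measurable N) (hN1 : ∀ᵐ x ∂S, N x = 1)
    (hNr : ∀ r : ℝ, 0 < r → ∀ x, N (r • x) = r * N x)
    {T : E → E} (hT : MeasurePreserving T ν ν) (hTN : ∀ x, N (T x) = N x)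
    (hTr : ∀ (r : ℝ) x, T (r • x) = r • T x) : S.map T = S := by
  have hTm := hT.measurable
  ext A hA
  rw [Measure.map_apply hTm hA]
  -- The indicator of the truncated cone over A; on rx with N x = 1 and r > 0 it separates into a
  -- function of r and the indicator of A at x.
  let f : E → ℝ≥0∞ := Set.indicator {z | N z ≤ 1} fun z => A.indicator 1 ((N z)⁻¹ • z)
  have hf : Measurable f := by
    refine Measurable.indicator ?_ (measurableSet_le hN measurable_const)
    exact (measurable_one.indicator hA).comp (hN.inv.smul measurable_id)
  have hfr (r : ℝ) (hr : 0 < r) (x : E) (hx : N x = 1) :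
      f (r • x) = (Set.Iic (1 : ℝ)).indicator 1 r * A.indicator 1 x := by
    have h1 : N (r • x) = r := by rw [hNr r hr, hx, mul_one]
    by_cases h : r ≤ 1
    · rw [Set.indicator_of_mem (s := Set.Iic (1 : ℝ)) h]
      simp only [f]
      rw [Set.indicator_of_mem (show r • x ∈ {z | N z ≤ 1} by simpa [h1] using h), h1, smul_smul,
        inv_mul_cancel₀ hr.ne', one_smul, Pi.one_apply, one_mul]
    · rw [Set.indicator_of_notMem (s := Set.Iic (1 : ℝ)) h, zero_mul]
      exact Set.indicator_of_notMem (by simpa [h1] using h) _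
  set c : ℝ≥0∞ := ∫⁻ r in Set.Ioi (0 : ℝ),
    ENNReal.ofReal (r ^ k) * (Set.Iic (1 : ℝ)).indicator 1 r with hc
  have hmc : Measurable fun r : ℝ => ENNReal.ofReal (r ^ k) * (Set.Iic (1 : ℝ)).indicator 1 r :=
    Measurable.mul (by fun_prop) (measurable_one.indicator measurableSet_Iic)
  have hfc : C * ∫⁻ z, f z ∂ν = c * S A := by
    rw [← hpolar f hf, hc, ← lintegral_mul_const _ hmc]
    refine setLIntegral_congr_fun measurableSet_Ioi fun r hr => ?_
    rw [mul_assoc, lintegral_congr_ae (hN1.mono fun x hx => hfr r hr x hx),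
      lintegral_const_mul _ (measurable_one.indicator hA), lintegral_indicator_one hA]
  have hfTc : C * ∫⁻ z, f (T z) ∂ν = c * S (T ⁻¹' A) := by
    rw [← hpolar (fun z => f (T z)) (hf.comp hTm), hc, ← lintegral_mul_const _ hmc]
    refine setLIntegral_congr_fun measurableSet_Ioi fun r hr => ?_
    have hTA : Measurable fun x => A.indicator (1 : E → ℝ≥0∞) (T x) :=
      (measurable_one.indicator hA).comp hTm
    simp only [hTr]
    rw [mul_assoc, lintegral_congr_ae (hN1.mono fun x hx => hfr r hr (T x) ((hTN x).trans hx)),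
      lintegral_const_mul _ hTA,
      ← lintegral_indicator_one (hTm hA)]
    rfl
  -- Invariance of ν gives c S(A) = c S(T⁻¹ A). Only 0 < c < ∞ is needed, where c is the integral of
  -- r^k over (0, 1]; nothing is required of C.
  rw [hT.lintegral_comp hf, hfc] at hfTc
  have hc0 : c ≠ 0 := by
    rw [hc, Ne, lintegral_eq_zero_iff hmc, Filter.EventuallyEq, ae_iff,
      Measure.restrict_apply' measurableSet_Ioi]
    intro h0
    have hsub : Set.Ioc (0 : ℝ) 1 ⊆ {r | ¬(ENNReal.ofReal (r ^ k) *
        (Set.Iic (1 : ℝ)).indicator 1 r = (0 : ℝ → ℝ≥0∞) r)} ∩ Set.Ioi 0 := by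
      intro r hr
      refine ⟨?_, hr.1⟩
      have : 0 < r ^ k := pow_pos hr.1 k
      simpa [this] using hr.2
    have := measure_mono_null hsub h0
    simp at this
  have hctop : c ≠ ∞ := by
    have hle : c ≤ ∫⁻ r in Set.Ioi (0 : ℝ), (Set.Iic (1 : ℝ)).indicator 1 r := by
      refine setLIntegral_mono (measurable_one.indicator measurableSet_Iic) fun r hr => ?_
      by_cases h : r ≤ 1
      · rw [Set.indicator_of_mem (s := Set.Iic (1 : ℝ)) h, Pi.one_apply, mul_one]
        exact ENNReal.ofReal_le_one.2 (pow_le_one₀ (le_of_lt hr) h)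
      · rw [Set.indicator_of_notMem (s := Set.Iic (1 : ℝ)) h, mul_zero]
    refine ne_top_of_le_ne_top ?_ hle
    rw [lintegral_indicator_one measurableSet_Iic, Measure.restrict_apply measurableSet_Iic,
      Set.inter_comm, Set.Ioi_inter_Iic]
    simp
  exact ((ENNReal.mul_right_inj hc0 hctop).1 hfTc).symm

/-- The Euclidean norm on `ℂ^d`. -/
def euclNorm {d : ℕ} (x : Fin d → ℂ) : ℝ := Real.sqrt (∑ i, ‖x i‖ ^ 2)

lemma euclNorm_vecMul {d : ℕ} {W : Matrix (Fin d) (Fin d) ℂ} (hW : W ∈ unitaryGroup (Fin d) ℂ)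
    (x : Fin d → ℂ) : euclNorm (x ᵥ* W) = euclNorm x := by
  have h (v : Fin d → ℂ) : ((∑ i, ‖v i‖ ^ 2 : ℝ) : ℂ) = v ⬝ᵥ star v := by
    push_cast
    refine Finset.sum_congr rfl fun i _ => ?_
    rw [Pi.star_apply, Complex.star_def, Complex.mul_conj, Complex.normSq_eq_norm_sq]
    push_cast
    rfl
  rw [euclNorm, euclNorm]
  congr 1
  have : ((∑ i, ‖(x ᵥ* W) i‖ ^ 2 : ℝ) : ℂ) = ((∑ i, ‖x i‖ ^ 2 : ℝ) : ℂ) := by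
    rw [h, h, star_vecMul, dotProduct_mulVec, vecMul_vecMul, ← star_eq_conjTranspose,
      mem_unitaryGroup_iff.1 hW, vecMul_one]
  exact_mod_cast this

lemma euclNorm_eq_one_ae (d : ℕ) : ∀ᵐ x ∂sphereMeasure d, euclNorm x = 1 := by
  have hm (d : ℕ) : MeasurableSet {x : Fin (d + 1) → ℂ | euclNorm x = 1} := by
    refine measurableSet_eq_fun ?_ measurable_const
    unfold euclNorm
    fun_prop
  induction d with
  | zero =>
    rw [sphereMeasure, ae_map_iff (by fun_prop) (hm 0)]
    refine norm_eq_one_ae_circleMeasure.mono fun u hu => ?_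
    simp [euclNorm, hu]
  | succ d ih =>
    rw [sphereMeasure, ae_map_iff (measurable_sphereMap d).aemeasurable (hm _)]
    have h1 := (Measure.quasiMeasurePreserving_fst (μ := circleMeasure)
      (ν := (phiMeasure (d + 1)).prod (sphereMeasure d))).ae norm_eq_one_ae_circleMeasure
    have h2 := (Measure.quasiMeasurePreserving_snd (μ := circleMeasure)
      (ν := (phiMeasure (d + 1)).prod (sphereMeasure d))).ae
        ((Measure.quasiMeasurePreserving_snd (μ := phiMeasure (d + 1))
      (ν := sphereMeasure d)).ae ih)
    filter_upwards [h1, h2] with p hp1 hp2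
    rw [euclNorm, Real.sqrt_eq_one] at hp2 ⊢
    rw [Fin.sum_univ_succ]
    simp only [Fin.cons_zero, Fin.cons_succ, Pi.smul_apply, smul_eq_mul, norm_mul, hp1, one_mul,
      mul_pow, ← Finset.mul_sum, hp2, Complex.norm_real, Real.norm_eq_abs, sq_abs, mul_one,
      Real.sin_sq_add_cos_sq]

/-- The real determinant of a complex linear map is the squared modulus of its complex determinant,
which is 1 for a unitary matrix. -/
lemma measurePreserving_vecMul {d : ℕ} {W : Matrix (Fin d) (Fin d) ℂ}
    (hW : W ∈ unitaryGroup (Fin d) ℂ) :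
    MeasurePreserving (fun x : Fin d → ℂ => x ᵥ* W) := by
  let L : (Fin d → ℂ) →ₗ[ℝ] (Fin d → ℂ) := (toLin' Wᵀ).restrictScalars ℝ
  have hL : (fun x : Fin d → ℂ => x ᵥ* W) = L := by
    ext1 x
    simp [L, toLin'_apply, mulVec_transpose]
  have hnorm : ‖W.det‖ = 1 := by
    have h := congrArg Matrix.det (mem_unitaryGroup_iff.1 hW)
    rw [det_mul, star_eq_conjTranspose, det_conjTranspose, det_one] at h
    have := congrArg norm h
    rw [norm_mul, norm_star, norm_one] at this
    nlinarith [norm_nonneg W.det]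
  have hdet : LinearMap.det L = 1 := by
    simp only [L]
    rw [LinearMap.det_restrictScalars, LinearMap.det_toLin', det_transpose,
      Algebra.norm_complex_apply, Complex.normSq_eq_norm_sq, hnorm, one_pow]
  rw [hL]
  refine ⟨(LinearMap.continuous_of_finiteDimensional L).measurable, ?_⟩
  rw [Measure.map_linearMap_addHaar_eq_smul_addHaar _ (by rw [hdet]; exact one_ne_zero), hdet]
  simp

/-- Unitary invariance of the uniform measure on the sphere. -/
theorem map_vecMul_sphereMeasure {d : ℕ} {W : Matrix (Fin (d + 1)) (Fin (d + 1)) ℂ}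
    (hW : W ∈ unitaryGroup (Fin (d + 1)) ℂ) :
    (sphereMeasure d).map (fun x => x ᵥ* W) = sphereMeasure d := by
  obtain ⟨C, hC⟩ := exists_lintegral_polar_sphereMeasure d
  refine map_eq_self_of_polar hC (N := euclNorm) ?_ (euclNorm_eq_one_ae d) ?_
    (measurePreserving_vecMul hW) (euclNorm_vecMul hW) fun r x => smul_vecMul r x W
  · unfold euclNorm
    fun_prop
  · intro r hr x
    simp only [euclNorm, Pi.smul_apply, norm_smul, mul_pow, ← Finset.mul_sum]
    rw [Real.sqrt_mul (by positivity), Real.sqrt_sq (norm_nonneg r), Real.norm_of_nonneg hr.le]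

/-- Both rotations and complex conjugation are needed below: the entries of H contain e^{-iψ}, while
`circleMeasure` is the law of e^{iθ}. -/
lemma map_circleMeasure (T : ℂ ≃ₗᵢ[ℝ] ℂ) : circleMeasure.map T = circleMeasure := by
  refine map_eq_self_of_polar (k := 1) (ν := volume) (C := ENNReal.ofReal (1 / (2 * Real.pi))) (fun f hf => ?_) measurable_norm
    norm_eq_one_ae_circleMeasure ?_ T.measurePreserving T.norm_map T.map_smul
  · rw [← lintegral_polar_circleMeasure hf]
    simp only [pow_one]
  · intro r hr x
    rw [norm_smul, Real.norm_of_nonneg hr.le]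

lemma lintegral_angleMeasure (T : ℂ ≃ₗᵢ[ℝ] ℂ) {f : ℂ → ℝ≥0∞} (hf : Measurable f) :
    ∫⁻ θ, f (T (Complex.exp (Complex.I * (θ : ℂ)))) ∂angleMeasure = ∫⁻ u, f u ∂circleMeasure := by
  have hT : Measurable T := T.continuous.measurable
  rw [← map_circleMeasure T, lintegral_map hf hT, circleMeasure]
  exact (lintegral_map (hf.comp hT) measurable_exp_I).symm

lemma lintegral_angleMeasure_neg {f : ℂ → ℝ≥0∞} (hf : Measurable f) :
    ∫⁻ θ, f (Complex.exp (-(Complex.I * (θ : ℂ)))) ∂angleMeasure = ∫⁻ u, f u ∂circleMeasure := by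
  rw [← lintegral_angleMeasure Complex.conjLIE hf]
  refine lintegral_congr fun θ => ?_
  rw [exp_neg_I_mul]
  rfl

lemma lintegral_angleMeasure_mul_neg {f : ℂ → ℝ≥0∞} (hf : Measurable f) {c : ℂ} (hc : ‖c‖ = 1) :
    ∫⁻ θ, f (c * -Complex.exp (-(Complex.I * (θ : ℂ)))) ∂angleMeasure =
      ∫⁻ u, f u ∂circleMeasure := by
  rw [← lintegral_angleMeasure (Complex.conjLIE.trans
    (rotation ⟨-c, by simp [Submonoid.unitSphere, hc]⟩)) hf]
  refine lintegral_congr fun θ => ?_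
  rw [exp_neg_I_mul]
  congr 1
  change c * -star (Complex.exp (Complex.I * (θ : ℂ))) =
    -c * star (Complex.exp (Complex.I * (θ : ℂ)))
  ring

/-! ### The law of the last row of H. -/

lemma measurable_rowVec {X : Type*} [MeasurableSpace X] (d : ℕ) {k t : X → Fin d → ℂ}
    (hk : Measurable k) (ht : Measurable t) : Measurable fun x => rowVec d (k x) (t x) := by
  induction d with
  | zero => exact measurable_const
  | succ d ih =>
    simp only [rowVec]
    refine measurable_finCons (by fun_prop) ?_
    have := ih (k := fun x i => k x i.succ) (t := fun x i => t x i.succ) (by fun_prop) (by fun_prop)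
    fun_prop

/-- The coordinates `(α, φ, ψ)` of the last factor `H`. -/
abbrev RowAngles (d : ℕ) : Type := ℝ × (Fin d → ℝ) × (Fin d → ℝ)

/-- The coordinate measure of the angles of the last factor `H`. -/
def rowMeasure (d : ℕ) : Measure (RowAngles d) :=
  angleMeasure.prod ((Measure.pi fun j : Fin d => phiMeasure (d - j.val)).prod
    (Measure.pi fun _ : Fin d => angleMeasure))

instance isProbabilityMeasure_pi_phiMeasure (d : ℕ) :
    IsProbabilityMeasure (Measure.pi fun j : Fin d => phiMeasure (d - j.val)) := by
  have (j : Fin d) : IsProbabilityMeasure (phiMeasure (d - j.val)) := by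
    obtain ⟨e, he⟩ := Nat.exists_eq_add_of_lt j.isLt
    rw [show d - j.val = e + 1 by omega]
    infer_instance
  infer_instance

instance isProbabilityMeasure_rowMeasure (d : ℕ) : IsProbabilityMeasure (rowMeasure d) := by
  unfold rowMeasure
  infer_instance

lemma lintegral_rowMeasure (d : ℕ) {F : RowAngles d → ℝ≥0∞} (hF : Measurable F) :
    ∫⁻ p, F p ∂rowMeasure d = ∫⁻ a, ∫⁻ φ, ∫⁻ ψ, F (a, φ, ψ)
      ∂(Measure.pi fun _ : Fin d => angleMeasure)
      ∂(Measure.pi fun j : Fin d => phiMeasure (d - j.val)) ∂angleMeasure := by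
  rw [rowMeasure, lintegral_prod _ hF.aemeasurable]
  refine lintegral_congr fun a => ?_
  exact lintegral_prod _ (hF.comp measurable_prodMk_left).aemeasurable

/-- Removing the first index lowers d and j together, so the exponent parameter d - j is unchanged
and a copy of `rowMeasure d` remains. The integral over the first ψ is placed innermost so that it
can absorb phases depending on α. -/
lemma lintegral_rowMeasure_succ (d : ℕ) {F : RowAngles (d + 1) → ℝ≥0∞} (hF : Measurable F) :
    ∫⁻ p, F p ∂rowMeasure (d + 1) = ∫⁻ x, ∫⁻ p, ∫⁻ y,
      F (p.1, Fin.cons x p.2.1, Fin.cons y p.2.2) ∂angleMeasure ∂rowMeasure d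
        ∂phiMeasure (d + 1) := by
  have hpi : (fun i : Fin d => phiMeasure (d + 1 - i.succ.val)) =
      fun i : Fin d => phiMeasure (d - i.val) := by
    ext1 i
    rw [Fin.val_succ, Nat.add_sub_add_right]
  have hm : Measurable fun q : ((((ℝ × ℝ) × (Fin d → ℝ)) × (Fin d → ℝ)) × ℝ) =>
      F (q.1.1.1.1, Fin.cons q.1.1.1.2 q.1.1.2, Fin.cons q.2 q.1.2) :=
    hF.comp (Measurable.prodMk (by fun_prop) (Measurable.prodMk
      (measurable_finCons (by fun_prop) (by fun_prop))
      (measurable_finCons (by fun_prop) (by fun_prop))))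
  have hm1 := hm.lintegral_prod_right' (ν := angleMeasure)
  have hm2 := hm1.lintegral_prod_right' (ν := Measure.pi fun _ : Fin d => angleMeasure)
  have hm3 := hm2.lintegral_prod_right' (ν := Measure.pi fun j : Fin d => phiMeasure (d - j.val))
  have hR (x : ℝ) : ∫⁻ p, ∫⁻ y, F (p.1, Fin.cons x p.2.1, Fin.cons y p.2.2) ∂angleMeasure
      ∂rowMeasure d = ∫⁻ a, ∫⁻ φ, ∫⁻ ψ, ∫⁻ y, F (a, Fin.cons x φ, Fin.cons y ψ) ∂angleMeasure
      ∂(Measure.pi fun _ : Fin d => angleMeasure)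
      ∂(Measure.pi fun j : Fin d => phiMeasure (d - j.val)) ∂angleMeasure := by
    refine lintegral_rowMeasure d
      (F := fun p => ∫⁻ y, F (p.1, Fin.cons x p.2.1, Fin.cons y p.2.2) ∂angleMeasure) ?_
    exact hm1.comp (f := fun p : RowAngles d => (((p.1, x), p.2.1), p.2.2)) (by fun_prop)
  simp only [hR]
  rw [lintegral_rowMeasure _ hF, lintegral_lintegral_swap
    (f := fun x a => ∫⁻ φ, ∫⁻ ψ, ∫⁻ y, F (a, Fin.cons x φ, Fin.cons y ψ) ∂angleMeasure
      ∂(Measure.pi fun _ : Fin d => angleMeasure)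
      ∂(Measure.pi fun j : Fin d => phiMeasure (d - j.val)))
    (hm3.comp measurable_swap).aemeasurable]
  refine lintegral_congr fun a => ?_
  have hmF : Measurable fun q : (Fin (d + 1) → ℝ) × (Fin (d + 1) → ℝ) => F (a, q.1, q.2) := by
    fun_prop
  rw [lintegral_pi_succ _ (hmF.lintegral_prod_right' (ν := Measure.pi fun _ => angleMeasure)), hpi]
  refine lintegral_congr fun x => lintegral_congr fun φ => ?_
  refine (lintegral_pi_succ (fun _ : Fin (d + 1) => angleMeasure)
    (hmF.comp (measurable_prodMk_left (x := (Fin.cons x φ : Fin (d + 1) → ℝ))))).trans ?_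
  refine lintegral_lintegral_swap ?_
  exact (hm.comp (f := fun q : ℝ × (Fin d → ℝ) => ((((a, x), φ), q.2), q.1))
    (by fun_prop)).aemeasurable

/-- Spherical coordinates on `ℂ^{d+1}`. -/
def sphereCoord (d : ℕ) (p : RowAngles d) : Fin (d + 1) → ℂ :=
  Complex.exp (-(Complex.I * (p.1 : ℂ))) • rowVec d (cosVec p.2.1) (sinCoef p.2.1 p.2.2)

lemma measurable_sinCoef {X : Type*} [MeasurableSpace X] {d : ℕ} {φ ψ : X → Fin d → ℝ}
    (hφ : Measurable φ) (hψ : Measurable ψ) : Measurable fun x => sinCoef (φ x) (ψ x) := by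
  unfold sinCoef
  fun_prop

lemma measurable_sphereCoord (d : ℕ) : Measurable (sphereCoord d) := by
  have := measurable_rowVec d (k := fun p : RowAngles d => cosVec p.2.1)
    (t := fun p => sinCoef p.2.1 p.2.2) (by unfold cosVec; fun_prop)
    (measurable_sinCoef (by fun_prop) (by fun_prop))
  unfold sphereCoord
  fun_prop

/-- Turning the first coordinate by a phase depending on `α` does not change the law. -/
lemma lintegral_cons_sphereCoord {d : ℕ} (ih : (rowMeasure d).map (sphereCoord d) = sphereMeasure d)
    {c : ℝ → ℂ} (hc : Measurable c) (hc1 : ∀ a, ‖c a‖ = 1)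
    {f : (Fin (d + 2) → ℂ) → ℝ≥0∞} (hf : Measurable f) :
    ∫⁻ p, f (Fin.cons (c p.1 * sinCoef p.2.1 p.2.2 0) ((Real.cos (p.2.1 0) : ℂ) •
      sphereCoord d (p.1, fun i => p.2.1 i.succ, fun i => p.2.2 i.succ))) ∂rowMeasure (d + 1) =
      ∫⁻ x, f x ∂sphereMeasure (d + 1) := by
  have hms := measurable_sphereCoord d
  have hm0 : Measurable fun p : RowAngles (d + 1) =>
      f (Fin.cons (c p.1 * sinCoef p.2.1 p.2.2 0) ((Real.cos (p.2.1 0) : ℂ) •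
        sphereCoord d (p.1, fun i => p.2.1 i.succ, fun i => p.2.2 i.succ))) := by
    refine hf.comp (measurable_finCons ?_ ?_)
    · have := measurable_sinCoef (X := RowAngles (d + 1)) (φ := fun p => p.2.1)
        (ψ := fun p => p.2.2) (by fun_prop) (by fun_prop)
      fun_prop
    · fun_prop
  have hmu : Measurable fun q : (ℝ × (Fin (d + 1) → ℂ)) × ℂ =>
      f (Fin.cons (q.2 * (Real.sin q.1.1 : ℂ)) ((Real.cos q.1.1 : ℂ) • q.1.2) :
        Fin (d + 2) → ℂ) :=
    hf.comp (measurable_finCons (by fun_prop) (by fun_prop))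
  have hmu1 := hmu.lintegral_prod_right' (ν := circleMeasure)
  rw [lintegral_rowMeasure_succ d hm0, lintegral_sphereMeasure_succ d hf]
  -- With all other angles fixed, c is a constant of modulus 1, and integrating over the first ψ
  -- makes the phase of the first entry uniform whatever c is.
  have hstep (x : ℝ) (p : RowAngles d) : ∫⁻ y, f (Fin.cons
      (c p.1 * sinCoef (Fin.cons x p.2.1 : Fin (d + 1) → ℝ) (Fin.cons y p.2.2) 0)
      ((Real.cos x : ℂ) • sphereCoord d p) : Fin (d + 2) → ℂ) ∂angleMeasure =
      ∫⁻ u, f (Fin.cons (u * (Real.sin x : ℂ)) ((Real.cos x : ℂ) • sphereCoord d p) :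
        Fin (d + 2) → ℂ) ∂circleMeasure := by
    rw [← lintegral_angleMeasure_mul_neg (f := fun u => f (Fin.cons (u * (Real.sin x : ℂ))
      ((Real.cos x : ℂ) • sphereCoord d p) : Fin (d + 2) → ℂ))
      (hf.comp (measurable_finCons (by fun_prop) (by fun_prop))) (hc1 p.1)]
    refine lintegral_congr fun y => ?_
    simp only [sinCoef, Fin.cons_zero, mul_neg, neg_mul, mul_assoc]
  simp only [Fin.cons_zero, Fin.cons_succ, hstep]
  have hmap (x : ℝ) : ∫⁻ p, ∫⁻ u, f (Fin.cons (u * (Real.sin x : ℂ))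
      ((Real.cos x : ℂ) • sphereCoord d p) : Fin (d + 2) → ℂ) ∂circleMeasure ∂rowMeasure d =
      ∫⁻ u, ∫⁻ z, f (Fin.cons (u * (Real.sin x : ℂ)) ((Real.cos x : ℂ) • z) : Fin (d + 2) → ℂ)
        ∂sphereMeasure d ∂circleMeasure := by
    rw [lintegral_lintegral_swap (f := fun u z => f (Fin.cons (u * (Real.sin x : ℂ))
      ((Real.cos x : ℂ) • z) : Fin (d + 2) → ℂ)), ← ih]
    · exact (lintegral_map (hmu1.comp measurable_prodMk_left) hms).symm
    exact (hf.comp (measurable_finCons (by fun_prop) (by fun_prop))).aemeasurable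
  simp only [hmap]
  refine lintegral_lintegral_swap (Measurable.aemeasurable ?_)
  have h3 : Measurable fun q : (ℝ × ℂ) × (Fin (d + 1) → ℂ) =>
      f (Fin.cons (q.1.2 * (Real.sin q.1.1 : ℂ)) ((Real.cos q.1.1 : ℂ) • q.2) :
        Fin (d + 2) → ℂ) :=
    hf.comp (measurable_finCons (by fun_prop) (by fun_prop))
  exact h3.lintegral_prod_right' (ν := sphereMeasure d)

lemma map_sphereCoord (d : ℕ) : (rowMeasure d).map (sphereCoord d) = sphereMeasure d := by
  induction d with
  | zero =>
    refine Measure.ext_of_lintegral _ fun f hf => ?_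
    rw [lintegral_map hf (measurable_sphereCoord 0)]
    refine (lintegral_rowMeasure 0 (hf.comp (measurable_sphereCoord 0))).trans ?_
    rw [sphereMeasure,
      lintegral_map hf (by fun_prop),
      ← lintegral_angleMeasure_neg (f := fun u => f fun _ => u) (by fun_prop)]
    refine lintegral_congr fun a => ?_
    have (φ ψ : Fin 0 → ℝ) : sphereCoord 0 (a, φ, ψ) =
        fun _ => Complex.exp (-(Complex.I * (a : ℂ))) := by
      ext i
      simp [sphereCoord, rowVec]
    simp [this]
  | succ d ih =>
    refine Measure.ext_of_lintegral _ fun f hf => ?_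
    -- In `sphereCoord` the phase of α also turns the first coordinate; in the last row of H it
    -- turns only the tail, and there c = 1 is used.
    rw [lintegral_map hf (measurable_sphereCoord _), ← lintegral_cons_sphereCoord ih
      (c := fun a => Complex.exp (-(Complex.I * (a : ℂ)))) (by fun_prop) norm_exp_neg_I_mul hf]
    refine lintegral_congr fun p => ?_
    congr 1
    ext i
    refine Fin.cases ?_ (fun i => ?_) i
    · simp [sphereCoord, rowVec]
    · simp only [sphereCoord, rowVec, Pi.smul_apply, Fin.cons_succ, smul_eq_mul]
      rw [mul_left_comm]
      rfl

/-- The law of the last row of `H` is the uniform measure on the sphere. -/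
theorem map_prodH_last (d : ℕ) :
    (rowMeasure (d + 1)).map (fun p => prodH p.1 p.2.1 p.2.2 (Fin.last (d + 1))) =
      sphereMeasure (d + 1) := by
  have hmeas : Measurable fun p : RowAngles (d + 1) =>
      prodH p.1 p.2.1 p.2.2 (Fin.last (d + 1)) := by
    simp only [prodH_last]
    refine measurable_rowVec _ ?_ (measurable_sinCoef (by fun_prop) (by fun_prop))
    unfold cosCoef
    refine measurable_pi_iff.2 fun j => ?_
    split_ifs <;> fun_prop
  refine Measure.ext_of_lintegral _ fun f hf => ?_
  rw [lintegral_map hf hmeas, ← lintegral_cons_sphereCoord (map_sphereCoord d) (c := fun _ => 1)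
    (by fun_prop) (by simp) hf]
  refine lintegral_congr fun p => ?_
  rw [prodH_last_eq_cons, one_mul]
  rfl

/-! ### Topology and Haar measure of the unitary group. -/

section Topology

variable (n : ℕ)

instance compactSpace_unitaryGroup : CompactSpace (unitaryGroup (Fin n) ℂ) := by
  have hK : IsCompact (Set.univ.pi fun _ : Fin n => Set.univ.pi fun _ : Fin n =>
      Metric.closedBall (0 : ℂ) 1) :=
    isCompact_univ_pi fun _ => isCompact_univ_pi fun _ => isCompact_closedBall _ _
  refine isCompact_iff_compactSpace.1 (hK.of_isClosed_subset
    (isClosed_unitary (R := Matrix (Fin n) (Fin n) ℂ)) ?_)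
  intro U hU i _ j _
  rw [mem_closedBall_zero_iff]
  exact entry_norm_bound_of_unitary hU i j

instance polishSpace_unitaryGroup : PolishSpace (unitaryGroup (Fin n) ℂ) := by
  have : PolishSpace (Matrix (Fin n) (Fin n) ℂ) :=
    inferInstanceAs (PolishSpace (Fin n → Fin n → ℂ))
  exact (isClosed_unitary (R := Matrix (Fin n) (Fin n) ℂ)).polishSpace

lemma exists_isHaarMeasure : ∃ μ : Measure (unitaryGroup (Fin n) ℂ),
    μ.IsHaarMeasure ∧ IsProbabilityMeasure μ :=
  ⟨Measure.haarMeasure ⊤, inferInstance, ⟨Measure.haarMeasure_self⟩⟩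

/-- Compact groups are unimodular: the image of μ under a right translation is again a Haar
probability measure, hence μ by uniqueness. -/
lemma lintegral_mul_right_eq_self_of_isHaarMeasure {n : ℕ} (μ : Measure (unitaryGroup (Fin n) ℂ))
    [μ.IsHaarMeasure] [IsProbabilityMeasure μ] (f : unitaryGroup (Fin n) ℂ → ℝ≥0∞)
    (hf : Measurable f) (g : unitaryGroup (Fin n) ℂ) : ∫⁻ x, f (x * g) ∂μ = ∫⁻ x, f x ∂μ := by
  have hp : IsProbabilityMeasure (μ.map (· * g)) :=
    Measure.isProbabilityMeasure_map (measurable_mul_const g).aemeasurable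
  have h : μ.map (· * g) = μ := Measure.isHaarMeasure_eq_of_isProbabilityMeasure _ _
  conv_rhs => rw [← h]
  rw [lintegral_map hf (measurable_mul_const g)]

end Topology

/-! ### From Haar measure on U(m) to Haar measure on U(m+1). -/

section Row

variable {m : ℕ}

/-- The last row of a unitary matrix. -/
def lastRow (W : unitaryGroup (Fin (m + 1)) ℂ) : Fin (m + 1) → ℂ := W.1 (Fin.last m)

lemma continuous_lastRow : Continuous (lastRow (m := m)) :=
  (continuous_apply (A := fun _ : Fin (m + 1) => Fin (m + 1) → ℂ) (Fin.last m)).comp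
    continuous_subtype_val

lemma lastRow_mul (U W : unitaryGroup (Fin (m + 1)) ℂ) : lastRow (U * W) = lastRow U ᵥ* W.1 := rfl

/-- The embedding `A ↦ diag(A, 1)` of unitary groups. -/
def diagOneU (A : unitaryGroup (Fin m) ℂ) : unitaryGroup (Fin (m + 1)) ℂ :=
  ⟨diagOne A.1, diagOne_mem_unitaryGroup.2 A.2⟩

lemma diagOneU_mul (A B : unitaryGroup (Fin m) ℂ) :
    diagOneU (A * B) = diagOneU A * diagOneU B :=
  Subtype.ext (diagOne_mul A.1 B.1)

lemma continuous_diagOne : Continuous (diagOne (m := m)) := by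
  refine continuous_matrix fun r s => ?_
  refine Fin.lastCases ?_ (fun r => ?_) r <;> refine Fin.lastCases ?_ (fun s => ?_) s
  · simp only [diagOne_last_last]; exact continuous_const
  · simp only [diagOne_last_castSucc]; exact continuous_const
  · simp only [diagOne_castSucc_last]; exact continuous_const
  · simp only [diagOne_castSucc_castSucc]; exact continuous_id.matrix_elem r s

lemma continuous_diagOneU : Continuous (diagOneU (m := m)) :=
  (continuous_diagOne.comp continuous_subtype_val).subtype_mk _

lemma exists_eq_diagOneU_mul {U W : unitaryGroup (Fin (m + 1)) ℂ} (h : lastRow U = lastRow W) :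
    ∃ A : unitaryGroup (Fin m) ℂ, W = diagOneU A * U := by
  obtain ⟨A, hA, hW⟩ := exists_eq_diagOne_mul W.2 U.2 h
  exact ⟨⟨A, hA⟩, Subtype.ext hW⟩

/-- A measurable function that is constant on the fibres of `lastRow` is a measurable function of
the last row. -/
lemma exists_measurable_comp_lastRow {F : unitaryGroup (Fin (m + 1)) ℂ → ℝ≥0∞}
    (hF : Measurable F) (h : ∀ U W, lastRow U = lastRow W → F U = F W) :
    ∃ Φ : (Fin (m + 1) → ℂ) → ℝ≥0∞, Measurable Φ ∧ ∀ W, F W = Φ (lastRow W) := by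
  have hrow : Measurable (lastRow (m := m)) := continuous_lastRow.measurable
  let Φ : (Fin (m + 1) → ℂ) → ℝ≥0∞ := Function.extend lastRow F 0
  have hΦ (W) : F W = Φ (lastRow W) :=
    (Function.FactorsThrough.extend_apply (fun U W h' => h U W h') 0 W).symm
  -- A Borel map out of a Polish space detects measurability of functions on its measurable range;
  -- this is where Polishness of the unitary group enters.
  have hΦr : Measurable (Set.domRestrict (Set.range lastRow) Φ) := by
    rw [← hrow.measurable_comp_iff_restrict]
    convert! hF using 1
    exact funext fun W => (hΦ W).symm
  have hr : MeasurableSet (Set.range (lastRow (m := m))) :=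
    (isCompact_range continuous_lastRow).isClosed.measurableSet
  obtain ⟨Ψ, hΨ, hΨΦ⟩ := (MeasurableEmbedding.subtype_coe hr).exists_measurable_extend hΦr
    fun _ => inferInstance
  refine ⟨Ψ, hΨ, fun W => (hΦ W).trans ?_⟩
  exact (congrFun hΨΦ ⟨lastRow W, W, rfl⟩).symm

/-- If `g` is Haar distributed on `U(m)` and the last row of `H` is uniformly distributed on the
sphere, then `diag(g, 1) H` is Haar distributed on `U(m+1)`. -/
theorem lintegral_diagOneU_mul {Θ : Type*} [MeasurableSpace Θ] (P : Measure Θ)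
    [IsProbabilityMeasure P] {H : Θ → unitaryGroup (Fin (m + 1)) ℂ} (hH : Measurable H)
    (hrow : P.map (fun p => lastRow (H p)) = sphereMeasure m)
    (lam : Measure (unitaryGroup (Fin m) ℂ)) [lam.IsHaarMeasure] [IsProbabilityMeasure lam]
    (μ : Measure (unitaryGroup (Fin (m + 1)) ℂ)) [μ.IsHaarMeasure] [IsProbabilityMeasure μ]
    {f : unitaryGroup (Fin (m + 1)) ℂ → ℝ≥0∞} (hf : Measurable f) :
    ∫⁻ p, ∫⁻ g, f (diagOneU g * H p) ∂lam ∂P = ∫⁻ W, f W ∂μ := by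
  have hι : Measurable (diagOneU (m := m)) := continuous_diagOneU.measurable
  have hlr : Measurable (lastRow (m := m)) := continuous_lastRow.measurable
  let F : unitaryGroup (Fin (m + 1)) ℂ → ℝ≥0∞ := fun W => ∫⁻ g, f (diagOneU g * W) ∂lam
  have hfm : Measurable fun q : unitaryGroup (Fin (m + 1)) ℂ × unitaryGroup (Fin m) ℂ =>
      f (diagOneU q.2 * q.1) := by fun_prop
  have hF : Measurable F := hfm.lintegral_prod_right'
  -- Here W = diag(A, 1) U, and right invariance of `lam` absorbs A into the average over g.
  have hFinv (U W) (h : lastRow U = lastRow W) : F U = F W := by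
    obtain ⟨A, rfl⟩ := exists_eq_diagOneU_mul h
    simp only [F]
    rw [← lintegral_mul_right_eq_self_of_isHaarMeasure lam _ (by fun_prop) A]
    simp only [diagOneU_mul, mul_assoc]
  obtain ⟨Φ, hΦ, hFΦ⟩ := exists_measurable_comp_lastRow hF hFinv
  -- F sees only the last row, and right multiplication by W preserves the uniform law of that row.
  have hconst (W : unitaryGroup (Fin (m + 1)) ℂ) : ∫⁻ p, F (H p * W) ∂P = ∫⁻ p, F (H p) ∂P := by
    have hv : Measurable fun x : Fin (m + 1) → ℂ => x ᵥ* W.1 :=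
      (measurePreserving_vecMul W.2).measurable
    simp only [hFΦ, lastRow_mul]
    rw [← lintegral_map (f := Φ) (g := fun p => lastRow (H p)) hΦ (hlr.comp hH),
      ← lintegral_map (f := fun x => Φ (x ᵥ* W.1)) (g := fun p => lastRow (H p)) (hΦ.comp hv)
        (hlr.comp hH), hrow, ← lintegral_map (f := Φ) hΦ hv, map_vecMul_sphereMeasure W.2]
  -- Average over a Haar distributed W and exchange the integrals; left invariance of μ removes
  -- first H p and then diag(g, 1).
  calc ∫⁻ p, ∫⁻ g, f (diagOneU g * H p) ∂lam ∂P
      = ∫⁻ W, ∫⁻ p, F (H p * W) ∂P ∂μ := by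
        simp only [hconst, lintegral_const, measure_univ, mul_one]
        rfl
    _ = ∫⁻ p, ∫⁻ W, F (H p * W) ∂μ ∂P :=
        lintegral_lintegral_swap (Measurable.aemeasurable (by fun_prop))
    _ = ∫⁻ W, F W ∂μ := by
        simp only [lintegral_mul_left_eq_self, lintegral_const, measure_univ, mul_one]
    _ = ∫⁻ g, ∫⁻ W, f (diagOneU g * W) ∂μ ∂lam :=
        lintegral_lintegral_swap hfm.aemeasurable
    _ = ∫⁻ W, f W ∂μ := by
        simp only [lintegral_mul_left_eq_self, lintegral_const, measure_univ, mul_one]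

end Row

/-! ### Continuity in the angles. -/

section Continuity

lemma continuous_phiMat {X : Type*} [TopologicalSpace X] {m : ℕ} (j : Fin m) {α : X → ℝ}
    {φ ψ : X → Fin m → ℝ} (hα : Continuous α) (hφ : Continuous φ) (hψ : Continuous ψ) :
    Continuous fun x => phiMat (α x) (φ x) (ψ x) j := by
  refine continuous_matrix fun r s => ?_
  simp only [phiMat, Matrix.of_apply]
  split_ifs <;> fun_prop

lemma continuous_prodH {X : Type*} [TopologicalSpace X] {m : ℕ} {α : X → ℝ}
    {φ ψ : X → Fin m → ℝ} (hα : Continuous α) (hφ : Continuous φ) (hψ : Continuous ψ) :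
    Continuous fun x => prodH (α x) (φ x) (ψ x) := by
  have h : (fun x => prodH (α x) (φ x) (ψ x)) = fun x => ((List.finRange m).map
      fun j => phiMat (α x) (φ x) (ψ x) j).prod := by
    ext1 x
    rw [prodH, List.ofFn_eq_map]
  rw [h]
  exact continuous_list_prod _ fun j _ => continuous_phiMat j hα hφ hψ

lemma continuous_V {X : Type*} [TopologicalSpace X] (n : ℕ) {α : X → Fin n → ℝ}
    {φ ψ : X → PairAngles n} (hα : Continuous α) (hφ : Continuous φ) (hψ : Continuous ψ) :
    Continuous fun x => V n (α x) (φ x) (ψ x) := by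
  induction n with
  | zero => exact continuous_const
  | succ n ih =>
    cases n with
    | zero =>
      refine continuous_matrix fun r s => ?_
      simp only [V, Matrix.of_apply]
      fun_prop
    | succ m =>
      simp only [V]
      refine (continuous_diagOne.comp (ih ?_ ?_ ?_)).matrix_mul (continuous_prodH ?_ ?_ ?_) <;>
        fun_prop

end Continuity

/-! ### Separating the angles of the last factor from the others. -/

section Splitting

/-- The factors may depend on the index, as `PairAngles` requires: its k-th component is a tuple of
length k. -/
lemma measurePreserving_init_last {n : ℕ} {X : Fin (n + 1) → Type*}
    [∀ i, MeasurableSpace (X i)] (μ : ∀ i, Measure (X i)) [∀ i, SigmaFinite (μ i)] :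
    MeasurePreserving (fun x : ∀ i, X i => ((fun i : Fin n => x i.castSucc), x (Fin.last n)))
      (Measure.pi μ) ((Measure.pi fun i : Fin n => μ i.castSucc).prod (μ (Fin.last n))) := by
  let s : (∀ i : Fin n, X i.castSucc) × X (Fin.last n) → ∀ i, X i := fun p =>
    Fin.snoc (α := X) p.1 p.2
  have hs : Measurable s := by
    refine measurable_pi_iff.2 fun i => ?_
    refine Fin.lastCases ?_ (fun i => ?_) i
    · simp only [s, Fin.snoc_last]
      exact measurable_snd
    · simp only [s, Fin.snoc_castSucc]
      exact (measurable_pi_apply i).comp measurable_fst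
  have hmap : Measure.pi μ =
      ((Measure.pi fun i : Fin n => μ i.castSucc).prod (μ (Fin.last n))).map s := by
    refine Measure.pi_eq fun A hA => ?_
    rw [Measure.map_apply hs (MeasurableSet.univ_pi hA), Fin.prod_univ_castSucc,
      ← Measure.pi_pi, ← Measure.prod_prod]
    congr 1
    ext p
    simp only [s, Set.mem_preimage, Set.mem_pi, Set.mem_univ, true_imp_iff, Set.mem_prod]
    constructor
    · intro h
      refine ⟨fun i => ?_, ?_⟩
      · simpa using h i.castSucc
      · simpa using h (Fin.last n)
    · rintro ⟨h1, h2⟩ i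
      refine Fin.lastCases ?_ (fun i => ?_) i
      · simpa using h2
      · simpa using h1 i
  have hr : Measurable fun x : ∀ i, X i =>
      ((fun i : Fin n => x i.castSucc), x (Fin.last n)) := by fun_prop
  refine ⟨hr, ?_⟩
  rw [hmap, Measure.map_map hr hs]
  convert! Measure.map_id using 2
  ext1 p
  simp [s]

lemma measurePreserving_prod_comm {A B C D : Type*} [MeasurableSpace A] [MeasurableSpace B]
    [MeasurableSpace C] [MeasurableSpace D] (a : Measure A) (b : Measure B) (c : Measure C)
    (d : Measure D) [SFinite a] [SFinite b] [SFinite c] [SFinite d] :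
    MeasurePreserving (fun p : (A × B) × (C × D) => ((p.1.1, p.2.1), (p.1.2, p.2.2)))
      ((a.prod b).prod (c.prod d)) ((a.prod c).prod (b.prod d)) := by
  refine ⟨by fun_prop, Measure.ext_of_lintegral _ fun f hf => ?_⟩
  rw [lintegral_map hf (by fun_prop), lintegral_prod _ (by fun_prop), lintegral_prod _
    (by fun_prop), lintegral_prod _ (by fun_prop), lintegral_prod _ (by fun_prop)]
  refine lintegral_congr fun x => ?_
  have h1 (y : B) : ∫⁻ q, f ((x, q.1), (y, q.2)) ∂c.prod d =
      ∫⁻ z, ∫⁻ w, f ((x, z), (y, w)) ∂d ∂c := lintegral_prod _ (by fun_prop)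
  have h2 (z : C) : ∫⁻ q, f ((x, z), q) ∂b.prod d =
      ∫⁻ y, ∫⁻ w, f ((x, z), (y, w)) ∂d ∂b := lintegral_prod _ (by fun_prop)
  simp only [h1, h2]
  exact lintegral_lintegral_swap (by fun_prop)

/-- The angles of `V_n` and those of `H_{n+1}` among the angles of `V_{n+1}`. -/
def splitAngles (n : ℕ) (θ : (Fin (n + 1) → ℝ) × PairAngles (n + 1) × PairAngles (n + 1)) :
    ((Fin n → ℝ) × PairAngles n × PairAngles n) × RowAngles n :=
  ((fun k => θ.1 k.castSucc, fun k => θ.2.1 k.castSucc, fun k => θ.2.2 k.castSucc),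
    (θ.1 (Fin.last n), θ.2.1 (Fin.last n), θ.2.2 (Fin.last n)))

lemma measurePreserving_splitAngles (n : ℕ) :
    MeasurePreserving (splitAngles n) (coordMeasure (n + 1))
      ((coordMeasure n).prod (rowMeasure n)) := by
  have h1 := measurePreserving_init_last fun _ : Fin (n + 1) => angleMeasure
  have h2 := measurePreserving_init_last fun k : Fin (n + 1) =>
    Measure.pi fun j : Fin k => phiMeasure (k.val - j.val)
  have h3 := measurePreserving_init_last fun k : Fin (n + 1) =>
    Measure.pi fun _ : Fin k => angleMeasure
  have h23 := (measurePreserving_prod_comm _ _ _ _).comp (h2.prod h3)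
  exact (measurePreserving_prod_comm _ _ _ _).comp (h1.prod h23)

end Splitting

/-! ### The image of the coordinate measure is Haar measure. -/

/-- The parametrisation as a map to the unitary group. -/
def unitaryV (n : ℕ) (θ : (Fin n → ℝ) × PairAngles n × PairAngles n) : unitaryGroup (Fin n) ℂ :=
  ⟨V n θ.1 θ.2.1 θ.2.2, V_mem_unitaryGroup n θ.1 θ.2.1 θ.2.2⟩

lemma measurable_unitaryV (n : ℕ) : Measurable (unitaryV n) :=
  ((continuous_V n continuous_fst (continuous_fst.comp continuous_snd)
    (continuous_snd.comp continuous_snd)).subtype_mk _).measurable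

/-- The last factor as an element of the unitary group. -/
def unitaryH (n : ℕ) (p : RowAngles n) : unitaryGroup (Fin (n + 1)) ℂ :=
  ⟨prodH p.1 p.2.1 p.2.2, prodH_mem_unitaryGroup p.1 p.2.1 p.2.2⟩

lemma measurable_unitaryH (n : ℕ) : Measurable (unitaryH n) :=
  ((continuous_prodH continuous_fst (continuous_fst.comp continuous_snd)
    (continuous_snd.comp continuous_snd)).subtype_mk _).measurable

instance isProbabilityMeasure_coordMeasure (n : ℕ) : IsProbabilityMeasure (coordMeasure n) := by
  unfold coordMeasure
  infer_instance

/-- For `n = 1` the last row of `V` is uniformly distributed on the circle. -/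
lemma map_lastRow_unitaryV_one :
    (coordMeasure 1).map (fun θ => lastRow (unitaryV 1 θ)) = sphereMeasure 0 := by
  have hm : Measurable fun θ => lastRow (unitaryV 1 θ) :=
    continuous_lastRow.measurable.comp (measurable_unitaryV 1)
  refine Measure.ext_of_lintegral _ fun f hf => ?_
  rw [lintegral_map hf hm, sphereMeasure, lintegral_map hf (by fun_prop), circleMeasure,
    lintegral_map (by fun_prop) measurable_exp_I]
  have h := (measurePreserving_splitAngles 0).lintegral_comp
    (f := fun q => f fun _ : Fin (0 + 1) => Complex.exp (Complex.I * (q.2.1 : ℂ))) (by fun_prop)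
  refine Eq.trans h ?_
  rw [lintegral_prod _ (by fun_prop)]
  simp only [lintegral_const, measure_univ, mul_one]
  refine (lintegral_rowMeasure 0
    (F := fun p => f fun _ : Fin (0 + 1) => Complex.exp (Complex.I * (p.1 : ℂ)))
    (by fun_prop)).trans ?_
  simp only [lintegral_const, measure_univ, mul_one]

/-- The image of the coordinate measure is the Haar probability measure. -/
theorem map_unitaryV (n : ℕ) (μ : Measure (unitaryGroup (Fin (n + 1)) ℂ)) [μ.IsHaarMeasure]
    [IsProbabilityMeasure μ] : (coordMeasure (n + 1)).map (unitaryV (n + 1)) = μ := by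
  induction n with
  | zero =>
    -- The base case also fits the general step: U(0) is trivial, diag(g, 1) = 1, and V itself plays
    -- the role of H.
    obtain ⟨lam, hlam, hlam'⟩ := exists_isHaarMeasure 0
    refine Measure.ext_of_lintegral _ fun f hf => ?_
    rw [← lintegral_diagOneU_mul (coordMeasure 1) (measurable_unitaryV 1)
      map_lastRow_unitaryV_one lam μ hf, lintegral_map hf (measurable_unitaryV 1)]
    refine lintegral_congr fun θ => ?_
    have h1 (g : unitaryGroup (Fin 0) ℂ) : diagOneU g = 1 := by
      rw [Subsingleton.elim g 1]
      exact Subtype.ext diagOne_one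
    simp only [h1, one_mul, lintegral_const, measure_univ, mul_one]
  | succ n ih =>
    obtain ⟨lam, hlam, hlam'⟩ := exists_isHaarMeasure (n + 1)
    have hV := measurable_unitaryV (n + 1)
    have hH := measurable_unitaryH (n + 1)
    have hι : Measurable (diagOneU (m := n + 1)) := continuous_diagOneU.measurable
    refine Measure.ext_of_lintegral _ fun f hf => ?_
    rw [← lintegral_diagOneU_mul (rowMeasure (n + 1)) hH (map_prodH_last n) lam μ hf,
      lintegral_map hf (measurable_unitaryV _), ← ih lam]
    have h := (measurePreserving_splitAngles (n + 1)).lintegral_comp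
      (f := fun q => f (diagOneU (unitaryV (n + 1) q.1) * unitaryH (n + 1) q.2)) (by fun_prop)
    refine Eq.trans h ?_
    rw [lintegral_prod_symm _ (by fun_prop)]
    refine lintegral_congr fun p => ?_
    rw [lintegral_map (by fun_prop) hV]

end HurwitzU

end

theorem propositionB (n : ℕ) (hn : 0 < n) :
    -- every parameter value gives a unitary matrix
    ∃ hV : ∀ (α : Fin n → ℝ) (φ ψ : HurwitzU.PairAngles n),
        HurwitzU.V n α φ ψ ∈ Matrix.unitaryGroup (Fin n) ℂ,
      -- every unitary matrix is obtained from angles in the stated ranges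
      (∀ W ∈ Matrix.unitaryGroup (Fin n) ℂ,
        ∃ (α : Fin n → ℝ) (φ ψ : HurwitzU.PairAngles n),
          HurwitzU.InRange α φ ψ ∧ HurwitzU.V n α φ ψ = W) ∧
      -- the angles are unique when all `φ` are in the open interval
      (∀ (α α' : Fin n → ℝ) (φ ψ φ' ψ' : HurwitzU.PairAngles n),
        HurwitzU.InRange α φ ψ → HurwitzU.InRange α' φ' ψ' →
        (∀ k j, φ k j ∈ Set.Ioo 0 (Real.pi / 2)) → (∀ k j, φ' k j ∈ Set.Ioo 0 (Real.pi / 2)) →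
        HurwitzU.V n α φ ψ = HurwitzU.V n α' φ' ψ' → α = α' ∧ φ = φ' ∧ ψ = ψ') ∧
      -- diagonal of the factor `U`, radii and phases of its partial products
      (∀ (α : Fin n → ℝ) (φ ψ : HurwitzU.PairAngles n), HurwitzU.InRange α φ ψ →
        ∀ L U : Matrix (Fin n) (Fin n) ℂ, HurwitzU.IsLU (HurwitzU.V n α φ ψ) L U →
          (∀ l : Fin n, U l l = HurwitzU.uDiag α φ l) ∧
          (∀ (l : ℕ) (_ : 1 ≤ l) (hl : l < n),
            0 < HurwitzU.radius φ l ∧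
            ∏ i : Fin l, U (Fin.castLE hl.le i) (Fin.castLE hl.le i) =
              (HurwitzU.radius φ l : ℂ) *
                Complex.exp (Complex.I * (HurwitzU.phaseArg hn α l : ℂ)))) ∧
      -- radii and phases of the principal minors, and the determinant
      (∀ (α : Fin n → ℝ) (φ ψ : HurwitzU.PairAngles n), HurwitzU.InRange α φ ψ →
        (∀ (l : ℕ) (_ : 1 ≤ l) (hl : l < n),
          0 ≤ HurwitzU.radius φ l ∧
          (HurwitzU.leading (HurwitzU.V n α φ ψ) l hl.le).det =
            (HurwitzU.radius φ l : ℂ) *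
              Complex.exp (Complex.I * (HurwitzU.phaseArg hn α l : ℂ))) ∧
        (HurwitzU.V n α φ ψ).det = Complex.exp (Complex.I * (α ⟨0, hn⟩ : ℂ))) ∧
      -- the normalised Haar measure in these coordinates
      (∀ μ : MeasureTheory.Measure (Matrix.unitaryGroup (Fin n) ℂ),
        (μ.IsHaarMeasure ∧ MeasureTheory.IsProbabilityMeasure μ) ↔
          μ = MeasureTheory.Measure.map
            (fun θ : (Fin n → ℝ) × HurwitzU.PairAngles n × HurwitzU.PairAngles n =>
              (⟨HurwitzU.V n θ.1 θ.2.1 θ.2.2, hV θ.1 θ.2.1 θ.2.2⟩ :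
                Matrix.unitaryGroup (Fin n) ℂ))
            (HurwitzU.coordMeasure n))
  := by
  obtain ⟨n, rfl⟩ := Nat.exists_eq_add_of_le' hn
  refine ⟨HurwitzU.V_mem_unitaryGroup (n + 1), HurwitzU.exists_V_eq n, HurwitzU.V_injective n,
    fun α φ ψ hr L U hLU => ⟨hLU.diag_eq hn, fun l h1 hl =>
      ⟨hLU.radius_pos hn hr l h1 hl.le, hLU.prod_diag hn l h1 hl.le⟩⟩,
    fun α φ ψ hr => ⟨fun l h1 hl => ⟨HurwitzU.radius_nonneg hr l,
      HurwitzU.det_leading_V (n + 1) hn α φ ψ l h1 hl.le⟩, HurwitzU.det_V n α φ ψ⟩,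
    fun μ => ⟨fun ⟨hμ, hμ'⟩ => (HurwitzU.map_unitaryV n μ).symm, ?_⟩⟩
  -- Conversely, some Haar probability measure exists, and by the direction already shown it equals
  -- the image measure.
  rintro rfl
  obtain ⟨μ, hμ, hμ'⟩ := HurwitzU.exists_isHaarMeasure (n + 1)
  have h := HurwitzU.map_unitaryV n μ
  exact h.symm ▸ ⟨hμ, hμ'⟩
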